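/- Let $\mathrm{SL}(2)=\{F\in\mathbb R^{2\times2}:\det F=1\}$, let $\|F\|^2=\sum_{i,j}F_{ij}^2$, and let $W:\mathrm{SL}(2)\to\mathbb R$ be objective and isotropic, i.e. $W(RF)=W(FR)=W(F)$ for all $F\in\mathrm{SL}(2)$, $R\in\mathrm{SO}(2)$, and bounded below. Put $\widehat W=W$ on $\mathrm{SL}(2)$ and $\widehat W=+\infty$ on $\mathbb R^{2\times2}\setminus\mathrm{SL}(2)$. Definitions. Let $w:\mathbb R^{2\times2}\to\mathbb R\cup\{+\infty\}$. It is *rank-one convex* if $w((1-t)F+t(F+H))\le(1-t)w(F)+t\,w(F+H)$ for all $F$, all $H$ of rank one and all $t\in[0,1]$. It is *polyconvex* if $w(F)=P(F,\det F)$ for some convex $P:\mathbb R^{2\times2}\times\mathbb R\to\mathbb R\cup\{+\infty\}$. It is *Borel quasiconvex* if it is Borel measurable and, for every $F_0$, every bounded open $\Omega\subset\mathbb R^2$ and every $\vartheta\in C_c^\infty(\Omega;\mathbb R^2)$, the integral $\int_\Omega w(F_0+\nabla\vartheta)\,dx$ exists in $(-\infty,+\infty]$ and is at least $w(F_0)\,|\Omega|$.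 It is *quasiconvex* if it is Borel quasiconvex and every point of $\{w<\infty\}$ has a neighbourhood $U$ such that $w$ is bounded above on $U\cap\{w<\infty\}$. For $V:\mathbb R^{2\times2}\to\mathbb R\cup\{+\infty\}$, the envelopes $RV,QV,PV,CV$ are the pointwise suprema of all functions $w\le V$ with values in $\mathbb R\cup\{+\infty\}$ that are respectively rank-one convex, quasiconvex, polyconvex and convex; $Q_{\mathrm B}V$ is the same supremum over all Borel quasiconvex $w\le V$. The convex envelope $C$ of a function on $\mathbb R$ is defined in the same way. For $W$ on $\mathrm{SL}(2)$ put $RW=(R\widehat W)|_{\mathrm{SL}(2)}$, and likewise for $QW,PW,CW,Q_{\mathrm B}W$. For $f:\mathbb R\to\mathbb R$ let $f^*(y)=\sup_{x\in\mathbb R}(xy-f(x))$ and $f^{**}=(f^*)^*$. Claim. There is exactly one function $\widetilde\phi:\mathbb R\to\mathbb R$ such that $W(F)=\widetilde\phi(\lambda_1-\lambda_2)$ for all $F\in\mathrm{SL}(2)$ with singular values $\lambda_1,\lambda_2$ (taken in either order). The function $$\overline W:\mathbb R^{2\times2}\to\mathbb R,\qquad \overline W(F)=\widetilde\phi\bigl(\sqrt{\|F\|^2-2\det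 F}\bigr),$$ extends $W$, and for every $F\in\mathrm{SL}(2)$ with singular values $\lambda_1,\lambda_2$ $$RW(F)=QW(F)=PW(F)=CW(F)=C\widetilde\phi(\lambda_1-\lambda_2)=\widetilde\phi^{**}\bigl(\sqrt{\|F\|^2-2\det F}\bigr)$$ $$=R\overline W(F)=Q\overline W(F)=P\overline W(F)=C\overline W(F).$$ If moreover $W$ is locally bounded above on $\mathrm{SL}(2)$, then also $Q_{\mathrm B}W(F)=Q_{\mathrm B}\overline W(F)=\widetilde\phi^{**}\bigl(\sqrt{\|F\|^2-2\det F}\bigr)$ for every $F\in\mathrm{SL}(2)$. -/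

import Mathlib

open MeasureTheory Topology
open scoped ContDiff MatrixGroups

noncomputable section

namespace PlanarRelaxation

/-- Real `2 × 2` matrices. -/
abbrev Mat : Type := Matrix (Fin 2) (Fin 2) ℝ

/-! ### Functions with values in `ℝ ∪ {+∞}`

They are modelled by functions into `EReal` that never take the value `⊥ = -∞`. -/

/-- `w` takes its values in `ℝ ∪ {+∞}`. -/
def NeverBot {E : Type*} (w : E → EReal) : Prop :=
  ∀ x, w x ≠ ⊥

/-- Convexity of a function with values in `ℝ ∪ {+∞}`, with the convention `0 · ∞ = 0`. -/
def IsConvexFn {E : Type*} [AddCommGroup E] [Module ℝ E] (w : E → EReal) : Prop :=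
  NeverBot w ∧ ∀ x y : E, ∀ t : ℝ, 0 ≤ t → t ≤ 1 →
    w ((1 - t) • x + t • y) ≤ ((1 - t : ℝ) : EReal) * w x + (t : EReal) * w y

/-- Rank-one convexity: convexity along all segments whose direction has rank one. -/
def IsRankOneConvex (w : Mat → EReal) : Prop :=
  NeverBot w ∧ ∀ F H : Mat, H.rank = 1 → ∀ t : ℝ, 0 ≤ t → t ≤ 1 →
    w ((1 - t) • F + t • (F + H)) ≤ ((1 - t : ℝ) : EReal) * w F + (t : EReal) * w (F + H)

/-- Polyconvexity: `w F = P (F, det F)` with `P` convex on `ℝ^{2×2} × ℝ`. -/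
def IsPolyconvex (w : Mat → EReal) : Prop :=
  ∃ P : Mat × ℝ → EReal, IsConvexFn P ∧ ∀ F : Mat, w F = P (F, F.det)

/-- The gradient matrix of a map of the plane, with entries `∂ⱼ ϑᵢ`. -/
def gradMat (ϑ : (Fin 2 → ℝ) → (Fin 2 → ℝ)) (x : Fin 2 → ℝ) : Mat :=
  LinearMap.toMatrix' ((fderiv ℝ ϑ x : (Fin 2 → ℝ) →L[ℝ] (Fin 2 → ℝ)) :
    (Fin 2 → ℝ) →ₗ[ℝ] (Fin 2 → ℝ))

/-- The integral over `Ω` of a function with values in `[-∞, +∞]`: the integral of the positive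
part minus that of the negative part. If both are infinite, the value is `⊥`, so that a finite
lower bound on this integral contains the assertion that the integral exists. -/
def eintegral (Ω : Set (Fin 2 → ℝ)) (f : (Fin 2 → ℝ) → EReal) : EReal :=
  ((∫⁻ x in Ω, (f x).toENNReal : ENNReal) : EReal) -
    ((∫⁻ x in Ω, (-(f x)).toENNReal : ENNReal) : EReal)

/-- The quasiconvexity inequality, tested with smooth maps compactly supported in `Ω`, for all
bounded open `Ω` in the plane. -/
def QuasiconvexIneq (w : Mat → EReal) : Prop :=
  ∀ F₀ : Mat, ∀ Ω : Set (Fin 2 → ℝ), IsOpen Ω → Bornology.IsBounded Ω →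
    ∀ ϑ : (Fin 2 → ℝ) → (Fin 2 → ℝ), ContDiff ℝ ∞ ϑ → HasCompactSupport ϑ → tsupport ϑ ⊆ Ω →
      w F₀ * ((volume Ω : ENNReal) : EReal) ≤ eintegral Ω (fun x => w (F₀ + gradMat ϑ x))

/-- Every point at which `w` is finite has a neighbourhood on which the finite values of `w` are
bounded above by a constant. -/
def LocBddAboveWhereFinite (w : Mat → EReal) : Prop :=
  ∀ F : Mat, w F ≠ ⊤ → ∃ U ∈ 𝓝 F, ∃ M : ℝ, ∀ G ∈ U, w G ≠ ⊤ → w G ≤ (M : EReal)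

/-- Quasiconvexity with Borel measurability as the only regularity. -/
def IsBorelQuasiconvex (w : Mat → EReal) : Prop :=
  NeverBot w ∧ Measurable[borel Mat] w ∧ QuasiconvexIneq w

/-- Quasiconvexity: a Borel function, locally bounded above where it is finite, that satisfies the
quasiconvexity inequality. -/
def IsQuasiconvex (w : Mat → EReal) : Prop :=
  IsBorelQuasiconvex w ∧ LocBddAboveWhereFinite w

/-- The pointwise supremum of all functions below `W` that have the property `P`. -/
def envelope {E : Type*} (P : (E → EReal) → Prop) (W : E → EReal) (x : E) : EReal :=
  sSup {y : EReal | ∃ w : E → EReal, P w ∧ (∀ z, w z ≤ W z) ∧ y = w x}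

/-- `RW`. -/
def rankOneEnvelope (W : Mat → EReal) : Mat → EReal := envelope IsRankOneConvex W

/-- `QW`. -/
def quasiconvexEnvelope (W : Mat → EReal) : Mat → EReal := envelope IsQuasiconvex W

/-- `QW` with merely Borel competitors. -/
def borelQuasiconvexEnvelope (W : Mat → EReal) : Mat → EReal := envelope IsBorelQuasiconvex W

/-- `PW`. -/
def polyconvexEnvelope (W : Mat → EReal) : Mat → EReal := envelope IsPolyconvex W

/-- `CW`, for functions on any real vector space. -/
def convexEnvelope {E : Type*} [AddCommGroup E] [Module ℝ E] (W : E → EReal) : E → EReal :=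
  envelope IsConvexFn W

/-- The extension of `W : SL(2) → ℝ` to all matrices by `+∞`. The envelopes of `W` are the
restrictions to `SL(2)` of the envelopes of this extension. -/
def extendTop (W : SL(2, ℝ) → ℝ) (F : Mat) : EReal :=
  open Classical in if h : F.det = 1 then ((W ⟨F, h⟩ : ℝ) : EReal) else ⊤

/-- `W (R F) = W F` for all rotations `R`. -/
def IsObjective (W : SL(2, ℝ) → ℝ) : Prop :=
  ∀ R F : SL(2, ℝ), (R : Mat) ∈ Matrix.specialOrthogonalGroup (Fin 2) ℝ → W (R * F) = W F

/-- `W (F R) = W F` for all rotations `R`. -/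
def IsIsotropic (W : SL(2, ℝ) → ℝ) : Prop :=
  ∀ R F : SL(2, ℝ), (R : Mat) ∈ Matrix.specialOrthogonalGroup (Fin 2) ℝ → W (F * R) = W F

/-- `a, b` are the two singular values of `F`, with multiplicity, in either order. -/
def HasSingularValues (F : Mat) (a b : ℝ) : Prop :=
  ((Matrix.toEuclideanLin F).singularValues 0 = a ∧
      (Matrix.toEuclideanLin F).singularValues 1 = b) ∨
    ((Matrix.toEuclideanLin F).singularValues 0 = b ∧
      (Matrix.toEuclideanLin F).singularValues 1 = a)

/-- `W F = φ (a - b)` for all `F` in `SL(2)` with singular values `a, b`, in either order. -/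
def Represents (φ : ℝ → ℝ) (W : SL(2, ℝ) → ℝ) : Prop :=
  ∀ F : SL(2, ℝ), ∀ a b : ℝ, HasSingularValues (F : Mat) a b → W F = φ (a - b)

/-- `√(‖F‖² - 2 det F)` with the Frobenius norm; the radicand is `(F₀₀ - F₁₁)² + (F₀₁ + F₁₀)²`. -/
def radius (F : Mat) : ℝ :=
  √((∑ i, ∑ j, F i j ^ 2) - 2 * F.det)

/-- The unconstrained extension `F ↦ φ (√(‖F‖² - 2 det F))`. -/
def conformalExtension (φ : ℝ → ℝ) (F : Mat) : EReal :=
  ((φ (radius F) : ℝ) : EReal)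

/-- The Legendre transform `f* y = sup_x (x y - f x)`. -/
def legendre (f : ℝ → EReal) (y : ℝ) : EReal :=
  ⨆ x : ℝ, (((x * y : ℝ) : EReal) - f x)

/-- The biconjugate `φ**` of a real-valued function. -/
def biconjugate (φ : ℝ → ℝ) : ℝ → EReal :=
  legendre (legendre fun x => ((φ x : ℝ) : EReal))

/-- Local boundedness from above on `SL(2)`. -/
def LocBddAbove (W : SL(2, ℝ) → ℝ) : Prop :=
  ∀ F : SL(2, ℝ), ∃ U ∈ 𝓝 F, BddAbove (W '' U)

end PlanarRelaxation

end

open PlanarRelaxation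

namespace PlanarRelaxation

/-! ### The biconjugate of a real function -/

/-! On `SL(2)` one has `radius F = |λ₁ - λ₂|`, and every `F` of determinant one equals `rot α *
shear s * rot β` with `s = radius F` (`exists_eq_rot_mul_shear_mul_rot`). So `F` lies on the line `t
↦ rot α * shear t * rot β`, which has rank-one direction, stays inside `SL(2)`, and carries `W` as
the one-variable function `φ`.

Upper bound: a competitor that is convex on such lines is, on this one, a real convex function below
`φ`, hence at most `φ**`. Lower bound: `φ**` is real (as `W` is bounded below), convex and even,
hence nondecreasing on `[0, ∞)`; composed with the seminorm `radius` it gives a finite continuous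
convex function below the conformal extension, which is a competitor in every class.
`Represents.envelope_eq` closes the sandwich.

Convexity on these lines is immediate for convex, polyconvex and rank-one convex competitors. For
quasiconvex ones it is the hard point (`QuasiconvexIneq.convexOn_shear`): a competitor may be `+∞`
off `SL(2)`, so only test maps whose total gradient has determinant one are useful. They are built
from the generating function `g y * c x`, where `g''` takes mainly two values and the cut-off `c`
varies slowly. The gradient is then one of two shears except on a small set, where it is nearly a
shear of bounded amount and the competitor is bounded above by compactness. Letting the exceptional
set shrink yields convexity. -/

theorem legendre_coe_le_coe_iff {φ : ℝ → ℝ} {y c : ℝ} :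
    legendre (fun x => ((φ x : ℝ) : EReal)) y ≤ (c : EReal) ↔ ∀ t, t * y - c ≤ φ t := by
  simp only [legendre, iSup_le_iff, ← EReal.coe_sub, EReal.coe_le_coe_iff]
  exact forall_congr' fun t => ⟨fun h => by linarith, fun h => by linarith⟩

theorem legendre_coe_ne_bot (φ : ℝ → ℝ) (y : ℝ) :
    legendre (fun x => ((φ x : ℝ) : EReal)) y ≠ ⊥ := by
  have h : (((0 * y - φ 0 : ℝ)) : EReal) ≤ legendre (fun x => ((φ x : ℝ) : EReal)) y :=
    le_iSup (fun x : ℝ => (((x * y : ℝ) : EReal) - ((φ x : ℝ) : EReal))) 0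
  intro hb
  rw [hb, le_bot_iff] at h
  exact EReal.coe_ne_bot _ h

/-- The biconjugate is the supremum of the affine minorants. -/
theorem biconjugate_le_coe_iff {φ : ℝ → ℝ} {x z : ℝ} :
    biconjugate φ x ≤ (z : EReal) ↔ ∀ y c : ℝ, (∀ t, t * y - c ≤ φ t) → x * y - c ≤ z := by
  unfold biconjugate
  rw [legendre, iSup_le_iff]
  constructor
  · intro h y c hc
    have h1 := (EReal.sub_le_sub le_rfl (legendre_coe_le_coe_iff.2 hc)).trans (h y)
    rw [← EReal.coe_sub, EReal.coe_le_coe_iff] at h1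
    linarith
  · intro h y
    induction hL : legendre (fun x => ((φ x : ℝ) : EReal)) y with
    | bot => exact absurd hL (legendre_coe_ne_bot φ y)
    | top => simp
    | coe c =>
      rw [← EReal.coe_sub, EReal.coe_le_coe_iff]
      have := h y c (legendre_coe_le_coe_iff.1 hL.le)
      linarith

theorem biconjugate_le (φ : ℝ → ℝ) (x : ℝ) : biconjugate φ x ≤ (φ x : EReal) :=
  biconjugate_le_coe_iff.2 fun _ _ h => h x

theorem le_biconjugate {φ : ℝ → ℝ} {y c : ℝ} (h : ∀ t, t * y - c ≤ φ t) (x : ℝ) :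
    ((x * y - c : ℝ) : EReal) ≤ biconjugate φ x := by
  have h1 : (((y * x : ℝ) : EReal) - legendre (fun x => ((φ x : ℝ) : EReal)) y) ≤
      biconjugate φ x :=
    le_iSup (fun y : ℝ => ((y * x : ℝ) : EReal) - legendre (fun x => ((φ x : ℝ) : EReal)) y) y
  refine le_trans ?_ h1
  rw [EReal.coe_sub, mul_comm x y]
  exact EReal.sub_le_sub le_rfl (legendre_coe_le_coe_iff.2 h)

/-- A lower bound of `φ` is an affine minorant of slope zero, which keeps the biconjugate away from
`⊥`. -/
theorem exists_biconjugate_eq_coe {φ : ℝ → ℝ} (hφ : BddBelow (Set.range φ)) :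
    ∃ ψ : ℝ → ℝ, ∀ x, biconjugate φ x = (ψ x : EReal) := by
  obtain ⟨m, hm⟩ := hφ
  refine ⟨fun x => (biconjugate φ x).toReal, fun x => (EReal.coe_toReal ?_ ?_).symm⟩
  · exact ne_top_of_le_ne_top (EReal.coe_ne_top _) (biconjugate_le φ x)
  · have := le_biconjugate (φ := φ) (y := 0) (c := -m)
      (fun t => by have := hm ⟨t, rfl⟩; linarith) x
    exact fun h => EReal.coe_ne_bot _ (le_bot_iff.1 (h ▸ this))

/-- A real convex function below `φ` is below the biconjugate of `φ`. -/
theorem _root_.ConvexOn.coe_le_biconjugate {h φ : ℝ → ℝ} (hc : ConvexOn ℝ Set.univ h)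
    (hle : ∀ t, h t ≤ φ t) (s : ℝ) : (h s : EReal) ≤ biconjugate φ s := by
  refine EReal.ge_of_forall_gt_iff_ge.1 fun a ha => ?_
  -- A real convex function on the line is continuous, so each value `a < h s` is attained at `s` by
  -- an affine minorant of `h`.
  obtain ⟨c, d, hcd, hs⟩ := ConvexOn.exists_affine_le_of_lt_real (Set.mem_univ s)
    (EReal.coe_lt_coe_iff.1 ha) isClosed_univ
    (hc.continuousOn isOpen_univ).lowerSemicontinuousOn hc
  have := le_biconjugate (φ := φ) (y := c) (c := -d)
    (fun t => by have := hcd t trivial; have := hle t; linarith) s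
  rwa [show s * c - -d = a by linarith] at this

/-! ### Envelopes -/

theorem envelope_mono_right {E : Type*} {P : (E → EReal) → Prop} {V W : E → EReal}
    (h : ∀ x, V x ≤ W x) (x : E) : envelope P V x ≤ envelope P W x := by
  refine sSup_le_sSup ?_
  rintro y ⟨w, hw, hV, rfl⟩
  exact ⟨w, hw, fun z => (hV z).trans (h z), rfl⟩

theorem le_envelope {E : Type*} {P : (E → EReal) → Prop} {w W : E → EReal} (hw : P w)
    (h : ∀ x, w x ≤ W x) (x : E) : w x ≤ envelope P W x :=
  le_sSup ⟨w, hw, h, rfl⟩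

theorem envelope_le {E : Type*} {P : (E → EReal) → Prop} {W : E → EReal} {x : E} {b : EReal}
    (h : ∀ w, P w → (∀ z, w z ≤ W z) → w x ≤ b) : envelope P W x ≤ b := by
  refine sSup_le ?_
  rintro y ⟨w, hw, hW, rfl⟩
  exact h w hw hW

theorem IsConvexFn.isRankOneConvex {w : Mat → EReal} (h : IsConvexFn w) : IsRankOneConvex w :=
  ⟨h.1, fun F H _ t h0 h1 => h.2 F (F + H) t h0 h1⟩

theorem IsConvexFn.isPolyconvex {w : Mat → EReal} (h : IsConvexFn w) : IsPolyconvex w :=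
  ⟨fun p => w p.1, ⟨fun p => h.1 p.1, fun x y t h0 h1 => h.2 x.1 y.1 t h0 h1⟩, fun _ => rfl⟩

theorem _root_.ConvexOn.isConvexFn {E : Type*} [AddCommGroup E] [Module ℝ E] {f : E → ℝ}
    (hf : ConvexOn ℝ Set.univ f) : IsConvexFn fun x => (f x : EReal) := by
  refine ⟨fun x => EReal.coe_ne_bot _, fun x y t h0 h1 => ?_⟩
  have := hf.2 (Set.mem_univ x) (Set.mem_univ y) (sub_nonneg.2 h1) h0 (by ring)
  simpa only [← EReal.coe_mul, ← EReal.coe_add, EReal.coe_le_coe_iff, smul_eq_mul] using this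

/-- A function with values in `ℝ ∪ {+∞}` is real and convex along a line on which it is bounded by a
real function and satisfies the convexity inequalities. -/
theorem convexOn_toReal_of_ereal {h : ℝ → EReal} (hbot : ∀ t, h t ≠ ⊥) (htop : ∀ t, h t ≠ ⊤)
    (hc : ∀ x y t : ℝ, 0 < t → t < 1 → x ≠ y →
      h ((1 - t) * x + t * y) ≤ ((1 - t : ℝ) : EReal) * h x + (t : EReal) * h y) :
    ConvexOn ℝ Set.univ fun t => (h t).toReal := by
  refine ⟨convex_univ, fun x _ y _ a b ha hb hab => ?_⟩
  obtain rfl : a = 1 - b := by linarith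
  -- The degenerate cases are split off because `hc` does not cover them: equal endpoints do not
  -- span a rank-one direction.
  rcases hb.eq_or_lt with rfl | hb'
  · simp
  rcases ha.eq_or_lt with ha' | ha'
  · obtain rfl : b = 1 := by linarith
    simp
  rcases eq_or_ne x y with rfl | hxy
  · simp only [← add_smul, hab, one_smul, le_refl]
  have := hc x y b hb' (by linarith) hxy
  have e : ∀ t, h t = ((h t).toReal : EReal) := fun t => (EReal.coe_toReal (htop t) (hbot t)).symm
  rw [e x, e y, e, ← EReal.coe_mul, ← EReal.coe_mul, ← EReal.coe_add, EReal.coe_le_coe_iff] at this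
  exact this

theorem le_biconjugate_of_convexOn_toReal {φ : ℝ → ℝ} {h : ℝ → EReal} (hbot : ∀ t, h t ≠ ⊥)
    (hle : ∀ t, h t ≤ (φ t : EReal))
    (hc : ConvexOn ℝ Set.univ fun t => (h t).toReal) (s : ℝ) : h s ≤ biconjugate φ s := by
  have htop : ∀ t, h t ≠ ⊤ := fun t => ne_top_of_le_ne_top (EReal.coe_ne_top _) (hle t)
  have e : ∀ t, h t = ((h t).toReal : EReal) := fun t => (EReal.coe_toReal (htop t) (hbot t)).symm
  rw [e s]
  exact hc.coe_le_biconjugate (fun t => EReal.coe_le_coe_iff.1 (e t ▸ hle t)) s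

theorem convexOn_of_coe_eq_biconjugate {φ ψ : ℝ → ℝ}
    (hψ : ∀ x, biconjugate φ x = (ψ x : EReal)) : ConvexOn ℝ Set.univ ψ := by
  refine ⟨convex_univ, fun x _ y _ a b ha hb hab => ?_⟩
  have hle := fun x => (hψ x).le
  rw [← EReal.coe_le_coe_iff, ← hψ, biconjugate_le_coe_iff]
  intro k c hk
  have h1 := biconjugate_le_coe_iff.1 (hle x) k c hk
  have h2 := biconjugate_le_coe_iff.1 (hle y) k c hk
  simp only [smul_eq_mul]
  have h3 : c = a * c + b * c := by rw [← add_mul, hab, one_mul]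
  nlinarith [mul_le_mul_of_nonneg_left h1 ha, mul_le_mul_of_nonneg_left h2 hb]

/-- Reflection turns an affine minorant of an even function into another one, of opposite slope. -/
theorem biconjugate_neg {φ : ℝ → ℝ} (hφ : ∀ t, φ (-t) = φ t) (x : ℝ) :
    biconjugate φ (-x) = biconjugate φ x := by
  have key : ∀ x, biconjugate φ (-x) ≤ biconjugate φ x := by
    intro x
    refine EReal.le_of_forall_lt_iff_le.1 fun z hz => ?_
    refine biconjugate_le_coe_iff.2 fun y c hy => ?_
    have := biconjugate_le_coe_iff.1 hz.le (-y) c fun t => by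
      have := hy (-t)
      rw [hφ] at this
      linarith
    linarith
  exact le_antisymm (key x) (by simpa using key (-x))

theorem convexEnvelope_coe_eq_biconjugate {φ : ℝ → ℝ} (hφ : BddBelow (Set.range φ)) (x : ℝ) :
    convexEnvelope (fun t : ℝ => ((φ t : ℝ) : EReal)) x = biconjugate φ x := by
  obtain ⟨ψ, hψ⟩ := exists_biconjugate_eq_coe hφ
  refine le_antisymm (envelope_le fun w hw hle => ?_) ?_
  · refine le_biconjugate_of_convexOn_toReal hw.1 hle ?_ x
    refine convexOn_toReal_of_ereal hw.1
      (fun t => ne_top_of_le_ne_top (EReal.coe_ne_top _) (hle t)) ?_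
    intro a b t h0 h1 _
    exact hw.2 a b t h0.le h1.le
  · rw [hψ]
    exact le_envelope (w := fun x => (ψ x : EReal))
      (convexOn_of_coe_eq_biconjugate hψ).isConvexFn (fun t => hψ t ▸ biconjugate_le φ t) x

/-! ### Planar matrices -/

theorem radius_eq (F : Mat) : radius F = √((F 0 0 - F 1 1) ^ 2 + (F 0 1 + F 1 0) ^ 2) := by
  rw [radius, Matrix.det_fin_two]
  congr 1
  simp only [Fin.sum_univ_two]
  ring

theorem radius_sq (F : Mat) : radius F ^ 2 = (F 0 0 - F 1 1) ^ 2 + (F 0 1 + F 1 0) ^ 2 := by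
  rw [radius_eq, Real.sq_sqrt (by positivity)]

theorem radius_nonneg (F : Mat) : 0 ≤ radius F := Real.sqrt_nonneg _

theorem continuous_radius : Continuous radius := by
  simp only [funext radius_eq]
  fun_prop

/-- `radius` is a seminorm: the norm of a vector in the plane depending linearly on the matrix. -/
theorem convexOn_radius : ConvexOn ℝ Set.univ radius := by
  have h : ∀ F : Mat, radius F = ‖(⟨F 0 0 - F 1 1, F 0 1 + F 1 0⟩ : ℂ)‖ := fun F => by
    rw [radius_eq, Complex.norm_eq_sqrt_sq_add_sq]
  refine ⟨convex_univ, fun F _ G _ a b ha hb hab => ?_⟩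
  rw [h, h F, h G]
  have e : (⟨(a • F + b • G) 0 0 - (a • F + b • G) 1 1,
      (a • F + b • G) 0 1 + (a • F + b • G) 1 0⟩ : ℂ) =
      a • (⟨F 0 0 - F 1 1, F 0 1 + F 1 0⟩ : ℂ) + b • (⟨G 0 0 - G 1 1, G 0 1 + G 1 0⟩ : ℂ) := by
    apply Complex.ext <;> simp <;> ring
  rw [e]
  refine (norm_add_le _ _).trans ?_
  rw [norm_smul, norm_smul, Real.norm_of_nonneg ha, Real.norm_of_nonneg hb]
  rfl

/-- If `0 ≤ x ≤ y` then `x` lies between `-y` and `y`, where `ψ` has equal values; hence `ψ` is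
nondecreasing on `[0, ∞)` and may be composed with a nonnegative convex function. -/
theorem convexOn_comp_radius {ψ : ℝ → ℝ} (hψ : ConvexOn ℝ Set.univ ψ) (heven : ∀ t, ψ (-t) = ψ t) :
    ConvexOn ℝ Set.univ fun F => ψ (radius F) := by
  have hmono : ∀ x y : ℝ, 0 ≤ x → x ≤ y → ψ x ≤ ψ y := by
    intro x y hx hxy
    have hseg : x ∈ segment ℝ (-y) y := by
      rw [segment_eq_Icc (by linarith)]
      exact ⟨by linarith, hxy⟩
    simpa [heven] using hψ.le_on_segment (Set.mem_univ _) (Set.mem_univ _) hseg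
  refine ⟨convex_univ, fun F _ G _ a b ha hb hab => ?_⟩
  exact (hmono _ _ (radius_nonneg _)
    (convexOn_radius.2 (Set.mem_univ F) (Set.mem_univ G) ha hb hab)).trans
    (hψ.2 (Set.mem_univ _) (Set.mem_univ _) ha hb hab)

/-- The simple shear by `t`. -/
def shear (t : ℝ) : Mat := !![1, t; 0, 1]

theorem det_shear (t : ℝ) : (shear t).det = 1 := by simp [shear]

theorem shear_mul_shear (s t : ℝ) : shear s * shear t = shear (s + t) := by
  simp [shear, add_comm]

theorem shear_zero : shear 0 = 1 := by
  rw [shear, Matrix.one_fin_two]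

theorem radius_shear_sq (t : ℝ) : radius (shear t) ^ 2 = t ^ 2 := by
  rw [radius_sq]; simp [shear]

/-- The rotation by `θ`. -/
noncomputable def rot (θ : ℝ) : Mat := !![Real.cos θ, -Real.sin θ; Real.sin θ, Real.cos θ]

theorem rot_mul_rot (a b : ℝ) : rot a * rot b = rot (a + b) := by
  ext i j
  fin_cases i <;> fin_cases j <;>
    simp [rot, Real.cos_add, Real.sin_add, Matrix.mul_apply] <;> ring

theorem rot_zero : rot 0 = 1 := by
  rw [rot, Matrix.one_fin_two]; simp

theorem det_rot (θ : ℝ) : (rot θ).det = 1 := by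
  rw [rot, Matrix.det_fin_two_of]
  linear_combination Real.cos_sq_add_sin_sq θ

theorem rot_mem (θ : ℝ) : rot θ ∈ Matrix.specialOrthogonalGroup (Fin 2) ℝ := by
  refine Matrix.mem_specialOrthogonalGroup_iff.2 ⟨?_, det_rot θ⟩
  rw [Matrix.mem_orthogonalGroup_iff]
  have h : star (rot θ) = rot (-θ) := by
    ext i j
    fin_cases i <;> fin_cases j <;> simp [rot, Matrix.star_apply]
  change rot θ * star (rot θ) = 1
  rw [h, rot_mul_rot, add_neg_cancel, rot_zero]

/-- In complex notation `F z = P z + U z̄`, with `|P|² - |U|² = det F = 1` and `2|U| = radius F`.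
Rotating by `α` on the left and `β` on the right multiplies `P` by `e^{i(α+β)}` and `U` by
`e^{i(α-β)}`, so half the sum and half the difference of the arguments make both parts real. -/
theorem exists_eq_rot_mul_diagonal_mul_rot {F : Mat} (hF : F.det = 1) {s : ℝ}
    (hs : radius F ^ 2 = s ^ 2) : ∃ α β : ℝ,
      F = rot α * !![√(1 + s ^ 2 / 4) + |s| / 2, 0; 0, √(1 + s ^ 2 / 4) - |s| / 2] * rot β := by
  rw [radius_sq] at hs
  rw [Matrix.det_fin_two] at hF
  set P : ℂ := ⟨(F 0 0 + F 1 1) / 2, (F 1 0 - F 0 1) / 2⟩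
  set U : ℂ := ⟨(F 0 0 - F 1 1) / 2, (F 0 1 + F 1 0) / 2⟩
  have hP : ‖P‖ = √(1 + s ^ 2 / 4) := by
    rw [Complex.norm_eq_sqrt_sq_add_sq]
    congr 1
    simp only [P]
    linear_combination hs / 4 + hF
  have hU : ‖U‖ = |s| / 2 := by
    rw [Complex.norm_eq_sqrt_sq_add_sq, ← Real.sqrt_sq (show (0 : ℝ) ≤ |s| / 2 by positivity)]
    congr 1
    have := sq_abs s
    simp only [U]
    linear_combination hs / 4 - this / 4
  refine ⟨(P.arg + U.arg) / 2, (P.arg - U.arg) / 2, ?_⟩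
  have c1 := Complex.norm_mul_cos_arg P
  have s1 := Complex.norm_mul_sin_arg P
  have c2 := Complex.norm_mul_cos_arg U
  have s2 := Complex.norm_mul_sin_arg U
  rw [← hP, ← hU]
  have e1 : P.arg = (P.arg + U.arg) / 2 + (P.arg - U.arg) / 2 := by ring
  have e2 : U.arg = (P.arg + U.arg) / 2 - (P.arg - U.arg) / 2 := by ring
  generalize (P.arg + U.arg) / 2 = α at *
  generalize (P.arg - U.arg) / 2 = β at *
  rw [e1, Real.cos_add] at c1
  rw [e1, Real.sin_add] at s1
  rw [e2, Real.cos_sub] at c2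
  rw [e2, Real.sin_sub] at s2
  simp only [P, U] at c1 s1 c2 s2
  ext i j
  fin_cases i <;> fin_cases j <;> simp [rot, Matrix.mul_apply]
  · linear_combination -c1 - c2
  · linear_combination s1 - s2
  · linear_combination -s1 - s2
  · linear_combination -c1 + c2

/-- A matrix of determinant one is a shear up to rotations on both sides. -/
theorem exists_eq_rot_mul_shear_mul_rot {F : Mat} (hF : F.det = 1) {s : ℝ}
    (hs : radius F ^ 2 = s ^ 2) : ∃ α β : ℝ, F = rot α * shear s * rot β := by
  -- `F` and `shear s` share determinant and radius, hence the same diagonal normal form.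
  obtain ⟨a, b, h⟩ := exists_eq_rot_mul_diagonal_mul_rot hF hs
  obtain ⟨a', b', h'⟩ := exists_eq_rot_mul_diagonal_mul_rot (det_shear s) (radius_shear_sq s)
  refine ⟨a - a', b - b', ?_⟩
  rw [h', h]
  generalize (!![√(1 + s ^ 2 / 4) + |s| / 2, 0; 0, √(1 + s ^ 2 / 4) - |s| / 2] : Mat) = D
  have e1 : rot a = rot (a - a') * rot a' := by rw [rot_mul_rot, sub_add_cancel]
  have e2 : rot b = rot b' * rot (b - b') := by rw [rot_mul_rot, add_sub_cancel]
  rw [e1, e2]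
  simp only [Matrix.mul_assoc]

/-- The trace and determinant of `Fᵀ F` are the sum and the product of the squared singular values.
Being nonnegative, these then have product `1 = det F`, so `(a - b)² = ‖F‖² - 2 det F`. -/
theorem sub_sq_of_hasSingularValues {F : Mat} (hF : F.det = 1) {a b : ℝ}
    (h : HasSingularValues F a b) : (a - b) ^ 2 = radius F ^ 2 := by
  set T := Matrix.toEuclideanLin F with hT
  have hn : Module.finrank ℝ (EuclideanSpace ℝ (Fin 2)) = 2 := by simp
  have hadj : LinearMap.adjoint T ∘ₗ T = Matrix.toLpLin 2 2 (F.conjTranspose * F) := by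
    rw [hT, Matrix.toLpLin_mul_same, Matrix.toEuclideanLin_conjTranspose_eq_adjoint]
  have htr : T.singularValues 0 ^ 2 + T.singularValues 1 ^ 2 = ∑ i, ∑ j, F i j ^ 2 := by
    have h1 := T.isSymmetric_adjoint_comp_self.trace_eq_sum_eigenvalues hn
    rw [Fin.sum_univ_two] at h1
    have h2 : T.singularValues 0 ^ 2 = T.isSymmetric_adjoint_comp_self.eigenvalues hn 0 :=
      T.sq_singularValues_of_lt hn (by norm_num)
    have h3 : T.singularValues 1 ^ 2 = T.isSymmetric_adjoint_comp_self.eigenvalues hn 1 :=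
      T.sq_singularValues_of_lt hn (by norm_num)
    rw [h2, h3]
    refine h1.symm.trans ?_
    rw [hadj, Matrix.toLpLin_eq_toLin, Matrix.trace_toLin_eq, Matrix.trace_fin_two]
    simp [Matrix.mul_apply, Fin.sum_univ_two]
    ring
  have hdet : T.singularValues 0 ^ 2 * T.singularValues 1 ^ 2 = 1 := by
    have h1 := T.isSymmetric_adjoint_comp_self.det_eq_prod_eigenvalues hn
    rw [Fin.prod_univ_two] at h1
    have h2 : T.singularValues 0 ^ 2 = T.isSymmetric_adjoint_comp_self.eigenvalues hn 0 :=
      T.sq_singularValues_of_lt hn (by norm_num)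
    have h3 : T.singularValues 1 ^ 2 = T.isSymmetric_adjoint_comp_self.eigenvalues hn 1 :=
      T.sq_singularValues_of_lt hn (by norm_num)
    rw [h2, h3]
    refine h1.symm.trans ?_
    rw [hadj, LinearMap.det_toLpLin]
    simp [hF]
  have hpos := mul_nonneg (T.singularValues_nonneg 0) (T.singularValues_nonneg 1)
  have hone : T.singularValues 0 * T.singularValues 1 = 1 := by
    nlinarith
  rw [radius_sq]
  rw [Matrix.det_fin_two] at hF
  simp only [Fin.sum_univ_two] at htr
  rcases h with ⟨rfl, rfl⟩ | ⟨rfl, rfl⟩ <;> linear_combination htr - 2 * hone + 2 * hF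

theorem hasSingularValues_singularValues (F : Mat) :
    HasSingularValues F ((Matrix.toEuclideanLin F).singularValues 0)
      ((Matrix.toEuclideanLin F).singularValues 1) := Or.inl ⟨rfl, rfl⟩

theorem HasSingularValues.symm {F : Mat} {a b : ℝ} (h : HasSingularValues F a b) :
    HasSingularValues F b a := Or.symm h

/-! ### The integral of extended real functions and Jensen's inequality -/

/-- Neither measurability nor integrability of the functions matters: subtraction in `EReal` is
monotone also with `⊤ - ⊤ = ⊥`. -/
theorem eintegral_mono {Ω : Set (Fin 2 → ℝ)} {f g : (Fin 2 → ℝ) → EReal} (hΩ : MeasurableSet Ω)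
    (h : ∀ x ∈ Ω, f x ≤ g x) : eintegral Ω f ≤ eintegral Ω g := by
  refine EReal.sub_le_sub ?_ ?_ <;> rw [EReal.coe_ennreal_le_coe_ennreal_iff]
  · exact setLIntegral_mono' hΩ fun x hx => EReal.toENNReal_le_toENNReal (h x hx)
  · exact setLIntegral_mono' hΩ fun x hx =>
      EReal.toENNReal_le_toENNReal (EReal.neg_le_neg_iff.2 (h x hx))

theorem eintegral_coe {Ω : Set (Fin 2 → ℝ)} {f : (Fin 2 → ℝ) → ℝ} (hf : IntegrableOn f Ω) :
    eintegral Ω (fun x => (f x : EReal)) = ((∫ x in Ω, f x : ℝ) : EReal) := by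
  have hn : ∫⁻ x in Ω, ENNReal.ofReal (-f x) ≠ ⊤ := (Integrable.lintegral_lt_top hf.neg).ne
  rw [integral_eq_lintegral_pos_part_sub_lintegral_neg_part hf, eintegral, EReal.coe_sub,
    EReal.coe_ennreal_toReal hf.lintegral_lt_top.ne, EReal.coe_ennreal_toReal hn]
  rfl

theorem integral_fderiv_apply_eq_zero {E G : Type*} [NormedAddCommGroup E] [NormedSpace ℝ E]
    [NormedAddCommGroup G] [NormedSpace ℝ G] [FiniteDimensional ℝ E] [MeasurableSpace E]
    [BorelSpace E] {μ : Measure E} [μ.IsAddHaarMeasure] {g : E → G} (hg : ContDiff ℝ 1 g)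
    (hs : HasCompactSupport g) (v : E) : ∫ x, fderiv ℝ g x v ∂μ = 0 := by
  have hc : Continuous fun x => fderiv ℝ g x v :=
    (hg.continuous_fderiv (by norm_num)).clm_apply continuous_const
  -- Integration by parts against the constant function `1`.
  have h := integral_smul_fderiv_eq_neg_fderiv_smul_of_integrable (μ := μ) (𝕜 := ℝ)
    (f := fun _ : E => (1 : ℝ)) (g := g) (v := v) (by simp)
    (by simpa using hc.integrable_of_hasCompactSupport (hs.fderiv_apply (𝕜 := ℝ) v))
    (by simpa using hg.continuous.integrable_of_hasCompactSupport hs)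
    (fun x _ => differentiableAt_const _) (fun x _ => hg.differentiable (by norm_num) x)
  simpa using h

theorem continuous_gradMat {ϑ : (Fin 2 → ℝ) → (Fin 2 → ℝ)} (h : ContDiff ℝ 1 ϑ) :
    Continuous (gradMat ϑ) := by
  have hc := h.continuous_fderiv (by norm_num)
  refine continuous_matrix fun i j => ?_
  simp only [gradMat, LinearMap.toMatrix'_apply]
  exact (continuous_apply i).comp (hc.clm_apply continuous_const)

theorem gradMat_eq_zero_of_notMem_tsupport {ϑ : (Fin 2 → ℝ) → (Fin 2 → ℝ)} {x : Fin 2 → ℝ}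
    (hx : x ∉ tsupport ϑ) : gradMat ϑ x = 0 := by
  have : fderiv ℝ ϑ x = 0 := by
    by_contra h
    exact hx (tsupport_fderiv_subset ℝ (subset_tsupport _ h))
  simp [gradMat, this]

theorem setIntegral_gradMat_apply_eq_zero {ϑ : (Fin 2 → ℝ) → (Fin 2 → ℝ)} (h : ContDiff ℝ 1 ϑ)
    (hs : HasCompactSupport ϑ) {Ω : Set (Fin 2 → ℝ)} (hΩ : tsupport ϑ ⊆ Ω) (i j : Fin 2) :
    ∫ x in Ω, gradMat ϑ x i j = 0 := by
  rw [setIntegral_eq_integral_of_forall_compl_eq_zero fun x hx => by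
    rw [gradMat_eq_zero_of_notMem_tsupport fun h => hx (hΩ h)]; rfl]
  have hc : Continuous fun x => fderiv ℝ ϑ x (Pi.single j 1) :=
    (h.continuous_fderiv (by norm_num)).clm_apply continuous_const
  have h0 := integral_fderiv_apply_eq_zero (μ := volume) h hs (Pi.single j 1)
  have h1 := eval_integral (μ := volume) (f := fun x => fderiv ℝ ϑ x (Pi.single j 1))
    (fun k => Integrable.eval
      (hc.integrable_of_hasCompactSupport (hs.fderiv_apply (𝕜 := ℝ) (Pi.single j 1))) k) i
  rw [h0] at h1
  simp only [gradMat, LinearMap.toMatrix'_apply]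
  exact h1.symm

/-- Jensen's inequality: continuous convex functions are quasiconvex. -/
theorem _root_.ConvexOn.quasiconvexIneq {f : Mat → ℝ} (hf : ConvexOn ℝ Set.univ f)
    (hc : Continuous f) : QuasiconvexIneq fun F => (f F : EReal) := by
  intro F₀ Ω hΩ hb ϑ hϑ hs hsub
  have hϑ1 : ContDiff ℝ 1 ϑ := hϑ.of_le (by norm_num)
  have hfin : volume Ω ≠ ⊤ := hb.measure_lt_top.ne
  have hint : ∀ {E : Type} [NormedAddCommGroup E] (g : (Fin 2 → ℝ) → E), Continuous g →
      IntegrableOn g Ω := fun g hg =>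
    (hg.continuousOn.integrableOn_compact hb.isCompact_closure).mono_set subset_closure
  -- The average in Jensen's inequality is taken in a normed space, so matrices are viewed as points
  -- of `Fin 2 → Fin 2 → ℝ`.
  let f' : (Fin 2 → Fin 2 → ℝ) → ℝ := fun F => f (Matrix.of F)
  have hf' : ConvexOn ℝ Set.univ f' :=
    ⟨convex_univ, fun x _ y _ a b ha hb hab => hf.2 (Set.mem_univ _) (Set.mem_univ _) ha hb hab⟩
  have hc' : Continuous f' := hc.comp continuous_id
  let g : (Fin 2 → ℝ) → (Fin 2 → Fin 2 → ℝ) := fun x i j => (F₀ + gradMat ϑ x) i j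
  have hcont : Continuous g := continuous_const.add (continuous_gradMat hϑ1)
  change (f F₀ : EReal) * _ ≤ eintegral Ω fun x => ((f' (g x) : ℝ) : EReal)
  rw [eintegral_coe (f := fun x => f' (g x)) (hint _ (hc'.comp hcont))]
  rcases eq_or_ne (volume Ω) 0 with h0 | h0
  · rw [h0, setIntegral_measure_zero _ h0]
    simp
  have hJ := hf'.map_set_average_le (μ := volume) (f := g) hc'.continuousOn
    isClosed_univ h0 hfin (by simp) (hint _ hcont) (hint _ (hc'.comp hcont))
  have hpos : 0 < volume.real Ω := ENNReal.toReal_pos h0 hfin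
  have hav : ⨍ x in Ω, g x = fun i j => F₀ i j := by
    rw [setAverage_eq]
    ext i j
    rw [Pi.smul_apply, Pi.smul_apply, eval_integral fun i => (hint g hcont).eval i,
      eval_integral fun j => ((hint g hcont).eval i).eval j]
    have hgm : Continuous fun x => gradMat ϑ x i j := (continuous_gradMat hϑ1).matrix_elem i j
    change (volume.real Ω)⁻¹ • ∫ x in Ω, (F₀ i j + gradMat ϑ x i j) = F₀ i j
    rw [integral_add (hint _ continuous_const) (hint _ hgm),
      setIntegral_gradMat_apply_eq_zero hϑ1 hs hsub, setIntegral_const, add_zero, smul_eq_mul,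
      smul_eq_mul, inv_mul_cancel_left₀ hpos.ne']
  rw [hav, setAverage_eq, smul_eq_mul, ← div_eq_inv_mul, le_div_iff₀ hpos] at hJ
  rw [← EReal.coe_ennreal_toReal hfin, ← EReal.coe_mul, EReal.coe_le_coe_iff]
  exact hJ

theorem _root_.ConvexOn.isQuasiconvex {f : Mat → ℝ} (hf : ConvexOn ℝ Set.univ f)
    (hc : Continuous f) : IsQuasiconvex fun F => (f F : EReal) := by
  refine ⟨⟨fun F => EReal.coe_ne_bot _, ?_, hf.quasiconvexIneq hc⟩, fun F _ => ?_⟩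
  · let : MeasurableSpace Mat := borel Mat
    have : BorelSpace Mat := ⟨rfl⟩
    exact (continuous_coe_real_ereal.comp hc).measurable
  · exact ⟨{G | f G < f F + 1}, (isOpen_lt hc continuous_const).mem_nhds (by simp), f F + 1,
      fun G hG _ => EReal.coe_le_coe_iff.2 (le_of_lt hG)⟩

/-! ### Profiles and cut-offs on the line -/

theorem contDiff_infty_of_hasDerivAt {f f' : ℝ → ℝ} (h : ∀ x, HasDerivAt f (f' x) x)
    (h' : ContDiff ℝ ∞ f') : ContDiff ℝ ∞ f := by
  rw [contDiff_infty_iff_deriv]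
  refine ⟨fun x => (h x).differentiableAt, ?_⟩
  rwa [funext fun x => (h x).deriv]

theorem exists_abs_le_of_eq_zero {f : ℝ → ℝ} (hf : Continuous f) {R : ℝ}
    (h : ∀ x, R ≤ |x| → f x = 0) : ∃ C, 0 < C ∧ ∀ x, |f x| ≤ C := by
  obtain ⟨C, hC⟩ := (isCompact_Icc (a := -R) (b := R)).exists_bound_of_continuousOn hf.continuousOn
  refine ⟨max C 1, by positivity, fun x => ?_⟩
  rcases le_total R |x| with hx | hx
  · rw [h x hx, abs_zero]; positivity
  · exact (hC x (abs_le.1 hx)).trans (le_max_left _ _)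

/-- The smooth bump of height one that is constant on `[-κ, κ]`. -/
noncomputable def plateau (κ : ℝ) (h0 : 0 < κ) (h1 : κ < 1) : ContDiffBump (0 : ℝ) :=
  -- The outer radius is the midpoint of `κ` and `1`, so the support stays strictly inside `(-1,
  -- 1)`.
  ⟨κ, (1 + κ) / 2, h0, by linarith⟩

section
variable {κ : ℝ} (h0 : 0 < κ) (h1 : κ < 1)

theorem plateau_eq_zero {x : ℝ} (hx : (1 + κ) / 2 ≤ |x|) : plateau κ h0 h1 x = 0 :=
  (plateau κ h0 h1).zero_of_le_dist (by simpa [plateau] using hx)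

theorem plateau_eq_one {x : ℝ} (hx : |x| ≤ κ) : plateau κ h0 h1 x = 1 :=
  (plateau κ h0 h1).one_of_mem_closedBall (by simpa [plateau] using hx)

end

/-- A smooth compactly supported function whose second derivative is mostly `α` or
`α * (1 - 1 / r)`. -/
theorem exists_profile (α : ℝ) {r κ : ℝ} (hr0 : 0 < r) (hr1 : r < 1) (hκ0 : 0 < κ) (hκ1 : κ < 1) :
    ∃ g g₁ g₂ : ℝ → ℝ, (∀ y, HasDerivAt g (g₁ y) y) ∧ (∀ y, HasDerivAt g₁ (g₂ y) y) ∧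
      ContDiff ℝ ∞ g ∧ ContDiff ℝ ∞ g₁ ∧
      (∀ y, (1 + κ) / 2 ≤ |y| → g y = 0 ∧ g₁ y = 0) ∧ (∀ y, |g₂ y| ≤ |α| * (1 + 1 / r)) ∧
      (∀ y, |y| ≤ κ * r → g₂ y = α * (1 - 1 / r)) ∧ ∀ y, r ≤ |y| → |y| ≤ κ → g₂ y = α := by
  set b := plateau κ hκ0 hκ1
  have hbz : ∀ {x : ℝ}, (1 + κ) / 2 ≤ |x| → b x = 0 := plateau_eq_zero hκ0 hκ1
  have hbo : ∀ {x : ℝ}, |x| ≤ κ → b x = 1 := plateau_eq_one hκ0 hκ1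
  let B : ℝ → ℝ := fun y => ∫ t in (0 : ℝ)..y, b t
  have hB : ∀ y, HasDerivAt B (b y) y := fun y =>
    (b.continuous.integral_hasStrictDerivAt 0 y).hasDerivAt
  have hBodd : ∀ y, B (-y) = -B y := fun y => by
    have := intervalIntegral.integral_comp_neg (a := 0) (b := y) (fun t => b t)
    simp only [b.neg, neg_zero] at this
    simp only [B]
    rw [this, intervalIntegral.integral_symm]
  -- The bumps `b y` and `b (y / r) / r` have the same integral, so the difference of their
  -- primitives has compact support. In its derivative both bumps act for `|y| ≤ κ r`, and only the
  -- wide one for `r ≤ |y| ≤ κ`.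
  let g₁ : ℝ → ℝ := fun y => α * (B y - B (y / r))
  let g₂ : ℝ → ℝ := fun y => α * (b y - b (y / r) * (1 / r))
  have hg₁ : ∀ y, HasDerivAt g₁ (g₂ y) y := fun y =>
    ((hB y).sub (HasDerivAt.comp y (h₂ := B) (h := fun y => y / r) (hB (y / r))
      ((hasDerivAt_id y).div_const r))).const_mul α
  have hbs : ContDiff ℝ ∞ b := b.contDiff
  have hg₂s : ContDiff ℝ ∞ g₂ :=
    contDiff_const.mul (hbs.sub ((hbs.comp (contDiff_id.div_const r)).mul contDiff_const))
  have hg₁s : ContDiff ℝ ∞ g₁ := contDiff_infty_of_hasDerivAt hg₁ hg₂s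
  have hg₁odd : ∀ y, g₁ (-y) = -g₁ y := fun y => by
    simp only [g₁, neg_div, hBodd]; ring
  have hz : ∀ y, (1 + κ) / 2 ≤ y → g₁ y = 0 := fun y hy => by
    have hy0 : 0 < y := by linarith
    have hle : y ≤ y / r := by rw [le_div_iff₀ hr0]; nlinarith
    have : B (y / r) - B y = 0 := by
      simp only [B]
      rw [intervalIntegral.integral_interval_sub_left
        (b.continuous.intervalIntegrable _ _) (b.continuous.intervalIntegrable _ _)]
      refine intervalIntegral.integral_zero_ae (Filter.Eventually.of_forall fun t ht => ?_)
      rw [Set.uIoc_of_le hle] at ht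
      exact hbz (by rw [abs_of_pos (hy0.trans ht.1)]; linarith [ht.1])
    simp only [g₁]
    rw [show B y - B (y / r) = 0 by linarith, mul_zero]
  have hz' : ∀ y, (1 + κ) / 2 ≤ |y| → g₁ y = 0 := fun y hy => by
    rcases le_total 0 y with h | h
    · exact hz y (by rwa [abs_of_nonneg h] at hy)
    · have := hg₁odd y
      rw [hz (-y) (by rwa [abs_of_nonpos h] at hy)] at this
      linarith
  -- The base point `-1` lies to the left of the support of `g₁`; since `g₁` is odd, `g` is even and
  -- vanishes on the right as well.
  let g : ℝ → ℝ := fun y => ∫ t in (-1 : ℝ)..y, g₁ t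
  have hg : ∀ y, HasDerivAt g (g₁ y) y := fun y =>
    (hg₁s.continuous.integral_hasStrictDerivAt (-1) y).hasDerivAt
  have hgz : ∀ y, y ≤ -((1 + κ) / 2) → g y = 0 := fun y hy => by
    refine intervalIntegral.integral_zero_ae (Filter.Eventually.of_forall fun t ht => ?_)
    have : t ≤ -((1 + κ) / 2) := (Set.mem_uIoc.1 ht).elim (fun h => h.2.trans hy)
      (fun h => by linarith [h.2])
    exact hz' t (by rw [abs_of_nonpos (by linarith)]; linarith)
  have hgeven : ∀ y, g y = g (-y) := fun y => by
    have h1 := intervalIntegral.integral_comp_neg (a := -y) (b := y) g₁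
    simp only [hg₁odd, neg_neg, intervalIntegral.integral_neg] at h1
    have h2 : g y - g (-y) = ∫ t in (-y)..y, g₁ t :=
      intervalIntegral.integral_interval_sub_left
        (hg₁s.continuous.intervalIntegrable _ _) (hg₁s.continuous.intervalIntegrable _ _)
    linarith
  refine ⟨g, g₁, g₂, hg, hg₁, contDiff_infty_of_hasDerivAt hg hg₁s, hg₁s,
    fun y hy => ⟨?_, hz' y hy⟩, fun y => ?_, fun y hy => ?_, fun y hy hy' => ?_⟩
  · rcases le_total 0 y with h | h
    · rw [hgeven]
      exact hgz _ (by rw [abs_of_nonneg h] at hy; linarith)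
    · exact hgz _ (by rw [abs_of_nonpos h] at hy; linarith)
  · have hb0 := fun x => b.nonneg (x := x)
    have hb1 := fun x => b.le_one (x := x)
    have hr : 0 < 1 / r := by positivity
    simp only [g₂]
    rw [abs_mul]
    refine mul_le_mul_of_nonneg_left (abs_le.2 ⟨?_, ?_⟩) (abs_nonneg _)
    · nlinarith [hb0 y, hb1 (y / r)]
    · nlinarith [hb1 y, hb0 (y / r)]
  · simp only [g₂]
    rw [hbo (by nlinarith), hbo (by rw [abs_div, abs_of_pos hr0, div_le_iff₀ hr0]; exact hy), one_mul]
  · simp only [g₂]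
    rw [hbo hy', hbz, zero_mul, sub_zero, mul_one]
    rw [abs_div, abs_of_pos hr0, le_div_iff₀ hr0]
    nlinarith

/-- Slowly varying smooth cut-offs. -/
theorem exists_cutoff {κ η : ℝ} (hκ0 : 0 < κ) (hκ1 : κ < 1) (hη : 0 < η) :
    ∃ L : ℝ, 0 < L ∧ ∃ c c₁ c₂ : ℝ → ℝ,
      (∀ x, HasDerivAt c (c₁ x) x) ∧ (∀ x, HasDerivAt c₁ (c₂ x) x) ∧
      ContDiff ℝ ∞ c ∧ ContDiff ℝ ∞ c₁ ∧
      (∀ x, (1 + κ) / 2 * L ≤ |x| → c x = 0 ∧ c₁ x = 0) ∧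
      (∀ x, |x| < κ * L → c x = 1 ∧ c₁ x = 0 ∧ c₂ x = 0) ∧
      ∀ x, |c x| ≤ 1 ∧ |c₁ x| ≤ η ∧ |c₂ x| ≤ η := by
  set b := plateau κ hκ0 hκ1
  have hbs : ContDiff ℝ ∞ b := b.contDiff
  have hb1s : ContDiff ℝ ∞ (deriv b) := (contDiff_infty_iff_deriv.1 hbs).2
  have hb2s : ContDiff ℝ ∞ (deriv (deriv b)) := (contDiff_infty_iff_deriv.1 hb1s).2
  have hb : ∀ x, HasDerivAt b (deriv b x) x := fun x =>
    ((contDiff_infty_iff_deriv.1 hbs).1 x).hasDerivAt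
  have hb1 : ∀ x, HasDerivAt (deriv b) (deriv (deriv b) x) x := fun x =>
    ((contDiff_infty_iff_deriv.1 hb1s).1 x).hasDerivAt
  have hball : ∀ x, |x| < κ → b =ᶠ[𝓝 x] 1 := fun x hx =>
    b.eventuallyEq_one_of_mem_ball (by simpa [b, plateau] using hx)
  -- Every zero of the nonnegative bump is a minimum, which also settles the boundary points `|x| =
  -- (1 + κ) / 2`.
  have hclosed : ∀ x, (1 + κ) / 2 ≤ |x| → deriv b x = 0 := by
    intro x hx
    have hmin : IsLocalMin b x := by
      refine Filter.Eventually.of_forall fun t => ?_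
      rw [plateau_eq_zero hκ0 hκ1 hx]
      exact b.nonneg
    exact hmin.deriv_eq_zero
  obtain ⟨C1, hC1, hC1'⟩ := exists_abs_le_of_eq_zero hb1s.continuous hclosed
  obtain ⟨C2, hC2, hC2'⟩ := exists_abs_le_of_eq_zero (R := 1) hb2s.continuous fun x hx => by
    have : deriv b =ᶠ[𝓝 x] fun _ => 0 := by
      filter_upwards [(isOpen_lt continuous_const continuous_abs).mem_nhds
        (show (1 + κ) / 2 < |x| by linarith)] with t ht
      exact hclosed t ht.le
    rw [this.deriv_eq, deriv_const]
  -- Stretching by `L` divides the first derivative by `L` and the second by `L²`; as `L ≥ 1`, a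
  -- bound on `C2 / L` suffices for the latter.
  set L := max 1 (max (C1 / η) (C2 / η))
  have hL1 : 1 ≤ L := le_max_left _ _
  have hL : 0 < L := by linarith
  have hLC1 : C1 / L ≤ η := by
    rw [div_le_iff₀ hL, mul_comm, ← div_le_iff₀ hη]
    exact (le_max_left _ _).trans (le_max_right _ _)
  have hLC2 : C2 / L ≤ η := by
    rw [div_le_iff₀ hL, mul_comm, ← div_le_iff₀ hη]
    exact (le_max_right _ _).trans (le_max_right _ _)
  have habs : ∀ x : ℝ, |x / L| = |x| / L := fun x => by rw [abs_div, abs_of_pos hL]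
  have hc : ∀ x, HasDerivAt (fun x => b (x / L)) (deriv b (x / L) * (1 / L)) x := fun x =>
    HasDerivAt.comp x (h₂ := b) (h := fun x => x / L) (hb (x / L)) ((hasDerivAt_id x).div_const L)
  have hc1 : ∀ x, HasDerivAt (fun x => deriv b (x / L) * (1 / L))
      (deriv (deriv b) (x / L) * (1 / L) * (1 / L)) x := fun x =>
    (HasDerivAt.comp x (h₂ := deriv b) (h := fun x => x / L) (hb1 (x / L))
      ((hasDerivAt_id x).div_const L)).mul_const _
  refine ⟨L, hL, _, _, _, hc, hc1, hbs.comp (contDiff_id.div_const L),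
    (hb1s.comp (contDiff_id.div_const L)).mul contDiff_const, fun x hx => ?_, fun x hx => ?_,
    fun x => ⟨?_, ?_, ?_⟩⟩
  · rw [← le_div_iff₀ hL, ← habs] at hx
    exact ⟨plateau_eq_zero hκ0 hκ1 hx, by rw [hclosed _ hx, zero_mul]⟩
  · rw [← div_lt_iff₀ hL, ← habs] at hx
    have e := hball _ hx
    have e1 := e.deriv
    have e2 := e1.deriv_eq
    have e1' := e1.eq_of_nhds
    have e' := e.eq_of_nhds
    refine ⟨e', ?_, ?_⟩
    · rw [e1']; simp [Pi.one_def]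
    · rw [e2]; simp [Pi.one_def]
  · rw [abs_of_nonneg b.nonneg]
    exact b.le_one
  · rw [abs_mul, abs_of_pos (show 0 < 1 / L by positivity), mul_one_div]
    exact (div_le_div_of_nonneg_right (hC1' _) hL.le).trans hLC1
  · rw [abs_mul, abs_mul, abs_of_pos (show 0 < 1 / L by positivity), mul_one_div]
    have h3 : |deriv (deriv b) (x / L)| / L ≤ η :=
      (div_le_div_of_nonneg_right (hC2' _) hL.le).trans hLC2
    calc _ = |deriv (deriv b) (x / L)| / L * (1 / L) := by ring
      _ ≤ η * (1 / L) := mul_le_mul_of_nonneg_right h3 (by positivity)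
      _ ≤ η * 1 := mul_le_mul_of_nonneg_left (by rw [div_le_one hL]; exact hL1) hη.le
      _ = η := mul_one η

/-! ### Area-preserving maps from generating functions -/

/-- A linear map of the plane as a continuous linear map. -/
noncomputable def planeMap (A : Mat) : (Fin 2 → ℝ) →L[ℝ] (Fin 2 → ℝ) :=
  LinearMap.toContinuousLinearMap (Matrix.toLin' A)

theorem planeMap_apply (A : Mat) (v : Fin 2 → ℝ) : planeMap A v = A.mulVec v := rfl

theorem det_planeMap (A : Mat) : (planeMap A).det = A.det := by
  simp [planeMap, LinearMap.det_toContinuousLinearMap]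

theorem _root_.HasFDerivAt.gradMat_eq {f : (Fin 2 → ℝ) → (Fin 2 → ℝ)} {A : Mat} {z : Fin 2 → ℝ}
    (h : HasFDerivAt f (planeMap A) z) : gradMat f z = A := by
  rw [gradMat, h.fderiv]
  exact LinearMap.toMatrix'_toLin' A

theorem hasFDerivAt_planeMap_gradMat {f : (Fin 2 → ℝ) → (Fin 2 → ℝ)} {z : Fin 2 → ℝ}
    (h : DifferentiableAt ℝ f z) : HasFDerivAt f (planeMap (gradMat f z)) z := by
  have : planeMap (gradMat f z) = fderiv ℝ f z := by
    ext1 v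
    rw [planeMap_apply, gradMat, LinearMap.toMatrix'_mulVec]
    rfl
  rw [this]
  exact h.hasFDerivAt

theorem planeMap_comp (A B : Mat) : (planeMap A).comp (planeMap B) = planeMap (A * B) := by
  ext1 v
  rw [ContinuousLinearMap.comp_apply, planeMap_apply, planeMap_apply, planeMap_apply,
    Matrix.mulVec_mulVec]

theorem hasFDerivAt_vec {u v : (Fin 2 → ℝ) → ℝ} {u₀ u₁ v₀ v₁ : ℝ} {z : Fin 2 → ℝ}
    (hu : HasFDerivAt u (u₀ • ContinuousLinearMap.proj (R := ℝ) (φ := fun _ : Fin 2 => ℝ) 0 +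
      u₁ • ContinuousLinearMap.proj (R := ℝ) (φ := fun _ : Fin 2 => ℝ) 1) z)
    (hv : HasFDerivAt v (v₀ • ContinuousLinearMap.proj (R := ℝ) (φ := fun _ : Fin 2 => ℝ) 0 +
      v₁ • ContinuousLinearMap.proj (R := ℝ) (φ := fun _ : Fin 2 => ℝ) 1) z) :
    HasFDerivAt (fun z => ![u z, v z]) (planeMap !![u₀, u₁; v₀, v₁]) z := by
  rw [hasFDerivAt_pi']
  intro i
  fin_cases i
  · convert! hu using 1
    ext1 w
    simp [planeMap_apply, dotProduct, Fin.sum_univ_two]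
  · convert! hv using 1
    ext1 w
    simp [planeMap_apply, dotProduct, Fin.sum_univ_two]

theorem hasFDerivAt_coord_mul {f f' g g' : ℝ → ℝ} (hf : ∀ x, HasDerivAt f (f' x) x)
    (hg : ∀ x, HasDerivAt g (g' x) x) (z : Fin 2 → ℝ) :
    HasFDerivAt (fun z : Fin 2 → ℝ => g (z 1) * f (z 0))
      ((g (z 1) * f' (z 0)) • ContinuousLinearMap.proj (R := ℝ) (φ := fun _ : Fin 2 => ℝ) 0 +
        (g' (z 1) * f (z 0)) • ContinuousLinearMap.proj (R := ℝ) (φ := fun _ : Fin 2 => ℝ) 1) z := by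
  have h0 := (hf (z 0)).comp_hasFDerivAt z (hasFDerivAt_apply (𝕜 := ℝ) 0 z)
  have h1 := (hg (z 1)).comp_hasFDerivAt z (hasFDerivAt_apply (𝕜 := ℝ) 1 z)
  convert! h1.mul h0 using 1
  ext1 w
  simp
  ring

/-- The gradient of the map with generating function `S`, in terms of `a = S_xy`, `c = S_xx` and
`d = S_yy`. -/
noncomputable def genGrad (a c d : ℝ) : Mat :=
  !![1 + a - d * c / (1 + a), d / (1 + a); -c / (1 + a), 1 / (1 + a)]

theorem det_genGrad {a : ℝ} (ha : 1 + a ≠ 0) (c d : ℝ) : (genGrad a c d).det = 1 := by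
  rw [genGrad, Matrix.det_fin_two_of]
  field_simp
  ring

theorem genGrad_zero_zero (d : ℝ) : genGrad 0 0 d = shear d := by
  simp [genGrad, shear]

/-- This is the chain rule `Dψ * DΦ = DΨ` for `ψ = Ψ ∘ Φ⁻¹`, with `Φ` and `Ψ` as in
`exists_areaPreserving`. -/
theorem genGrad_mul {a : ℝ} (ha : 1 + a ≠ 0) (c d : ℝ) :
    genGrad a c d * !![1, 0; c, 1 + a] = !![1 + a, d; 0, 1] := by
  ext i j
  fin_cases i <;> fin_cases j <;> simp [genGrad, Matrix.mul_apply, Fin.sum_univ_two] <;>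
    field_simp <;> ring

/-- The area-preserving map with generating function `g y * c x`. -/
theorem exists_areaPreserving {g g₁ g₂ c c₁ c₂ : ℝ → ℝ} (hg : ∀ y, HasDerivAt g (g₁ y) y)
    (hg₁ : ∀ y, HasDerivAt g₁ (g₂ y) y) (hgs : ContDiff ℝ ∞ g) (hg₁s : ContDiff ℝ ∞ g₁)
    (hc : ∀ x, HasDerivAt c (c₁ x) x) (hc₁ : ∀ x, HasDerivAt c₁ (c₂ x) x) (hcs : ContDiff ℝ ∞ c)
    (hc₁s : ContDiff ℝ ∞ c₁) (h1 : ∀ x y, |g₁ y * c₁ x| ≤ 1 / 4)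
    (h2 : ∀ x y, |g y * c₂ x| ≤ 1 / 4) :
    ∃ ψ : (Fin 2 → ℝ) → (Fin 2 → ℝ), ContDiff ℝ ∞ ψ ∧
      (∀ z : Fin 2 → ℝ, ∃ y, z = ![z 0, y + g y * c₁ (z 0)]) ∧
      ∀ x y : ℝ, ψ ![x, y + g y * c₁ x] = ![x + g₁ y * c x, y] ∧
        gradMat ψ ![x, y + g y * c₁ x] = genGrad (g₁ y * c₁ x) (g y * c₂ x) (g₂ y * c x) := by
  let p (i : Fin 2) := ContinuousLinearMap.proj (R := ℝ) (φ := fun _ : Fin 2 => ℝ) i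
  -- With `S = g y * c x`, the map `ψ` sends `(x, y + S_x)` to `(x + S_y, y)`. In the mixed
  -- coordinates `(x, y)`, source and target are the explicit maps `Φ` and `Ψ`, both of Jacobian `1
  -- + S_xy`; hence `ψ = Ψ ∘ Φ⁻¹` preserves area.
  let Φ : (Fin 2 → ℝ) → (Fin 2 → ℝ) := fun z => ![z 0, z 1 + g (z 1) * c₁ (z 0)]
  let Ψ : (Fin 2 → ℝ) → (Fin 2 → ℝ) := fun z => ![z 0 + g₁ (z 1) * c (z 0), z 1]
  let J (z : Fin 2 → ℝ) : Mat := !![1, 0; g (z 1) * c₂ (z 0), 1 + g₁ (z 1) * c₁ (z 0)]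
  have hpos : ∀ x y, 0 < 1 + g₁ y * c₁ x := fun x y => by linarith [(abs_le.1 (h1 x y)).1]
  have hp : ∀ (i : Fin 2) (z : Fin 2 → ℝ), HasFDerivAt (fun z : Fin 2 → ℝ => z i) (p i) z :=
    fun i z => hasFDerivAt_apply i z
  have hS := fun z => hasFDerivAt_coord_mul hc₁ hg z
  have hΦ : ∀ z, HasFDerivAt Φ (planeMap (J z)) z := fun z => by
    refine hasFDerivAt_vec ?_ ?_
    · convert hp 0 z using 1
      simp [p]
    · convert! (hp 1 z).add (hS z) using 1
      ext1 w
      simp [p]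
      ring
  have hΨ : ∀ z, HasFDerivAt Ψ
      (planeMap !![1 + g₁ (z 1) * c₁ (z 0), g₂ (z 1) * c (z 0); 0, 1]) z := fun z => by
    refine hasFDerivAt_vec ?_ ?_
    · convert! (hp 0 z).add (hasFDerivAt_coord_mul hc hg₁ z) using 1
      ext1 w
      simp [p]
      ring
    · convert hp 1 z using 1
      simp [p]
  -- `Φ - id` is `1/2`-Lipschitz by `h1` and `h2`, so `Φ` is a homeomorphism of the plane.
  have happ : ApproximatesLinearOn Φ
      ((ContinuousLinearEquiv.refl ℝ (Fin 2 → ℝ) : (Fin 2 → ℝ) ≃L[ℝ] (Fin 2 → ℝ)) :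
        (Fin 2 → ℝ) →L[ℝ] (Fin 2 → ℝ)) Set.univ (1 / 2) := by
    intro z _ w _
    have hlip := Convex.norm_image_sub_le_of_norm_hasFDerivWithin_le (C := 1 / 2) (s := Set.univ)
      (fun z _ => (hS z).hasFDerivWithinAt) (fun z _ => ?_) convex_univ (Set.mem_univ w)
      (Set.mem_univ z)
    · rw [pi_norm_le_iff_of_nonneg (by positivity)]
      intro i
      fin_cases i
      · simp [Φ]
      · have e : (Φ z - Φ w - (z - w)) 1 = g (z 1) * c₁ (z 0) - g (w 1) * c₁ (w 0) := by
          simp [Φ]; ring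
        simpa [e] using hlip
    · refine ContinuousLinearMap.opNorm_le_bound _ (by norm_num) fun v => ?_
      have hv0 := norm_le_pi_norm v 0
      have hv1 := norm_le_pi_norm v 1
      have e1 : ‖g (z 1) * c₂ (z 0) * v 0‖ ≤ 1 / 4 * ‖v‖ := by
        rw [norm_mul]
        exact mul_le_mul (h2 _ _) hv0 (norm_nonneg _) (by norm_num)
      have e2 : ‖g₁ (z 1) * c₁ (z 0) * v 1‖ ≤ 1 / 4 * ‖v‖ := by
        rw [norm_mul]
        exact mul_le_mul (h1 _ _) hv1 (norm_nonneg _) (by norm_num)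
      refine (norm_add_le _ _).trans ?_
      refine (add_le_add e1 e2).trans (le_of_eq ?_)
      ring
  let H : (Fin 2 → ℝ) ≃ₜ (Fin 2 → ℝ) := happ.toHomeomorph Φ (Or.inr (by
    rw [ContinuousLinearEquiv.refl_symm, ContinuousLinearEquiv.coe_refl]
    have : ‖ContinuousLinearMap.id ℝ (Fin 2 → ℝ)‖₊ = 1 := NNReal.eq ContinuousLinearMap.norm_id
    rw [this, inv_one]
    exact NNReal.half_lt_self one_ne_zero))
  have hHΦ : ∀ z, H z = Φ z := fun z => rfl
  have hdet : ∀ z, (planeMap (J z)).det ≠ 0 := fun z => by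
    rw [det_planeMap, Matrix.det_fin_two_of]
    simpa using (hpos (z 0) (z 1)).ne'
  have hcoord : ∀ i : Fin 2, ContDiff ℝ ∞ fun z : Fin 2 → ℝ => z i := fun i => contDiff_apply ℝ ℝ i
  have hΦs : ContDiff ℝ ∞ Φ := by
    rw [contDiff_pi]
    intro i
    fin_cases i
    · exact hcoord 0
    · exact (hcoord 1).add ((hgs.comp (hcoord 1)).mul (hc₁s.comp (hcoord 0)))
  have hΨs : ContDiff ℝ ∞ Ψ := by
    rw [contDiff_pi]
    intro i
    fin_cases i
    · exact (hcoord 0).add ((hg₁s.comp (hcoord 1)).mul (hcs.comp (hcoord 0)))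
    · exact hcoord 1
  have hHs : ContDiff ℝ ∞ H.symm :=
    H.contDiff_symm (f₀' := fun z => (planeMap (J z)).toContinuousLinearEquivOfDetNeZero (hdet z))
      (fun z => by
        rw [ContinuousLinearMap.coe_toContinuousLinearEquivOfDetNeZero]
        exact hΦ z) hΦs
  have hψs : ContDiff ℝ ∞ (Ψ ∘ H.symm) := hΨs.comp hHs
  have hψΦ : ∀ z, (Ψ ∘ H.symm) (Φ z) = Ψ z := fun z => congrArg Ψ (H.symm_apply_apply z)
  refine ⟨Ψ ∘ H.symm, hψs, fun z => ⟨H.symm z 1, ?_⟩, fun x y => ⟨?_, ?_⟩⟩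
  · have e : Φ (H.symm z) = z := H.apply_symm_apply z
    have e0 : H.symm z 0 = z 0 := congrFun e 0
    rw [← e0]
    exact e.symm
  · exact hψΦ ![x, y]
  · have hd := hasFDerivAt_planeMap_gradMat
      ((hψs.differentiable (by simp)) (Φ ![x, y]))
    have hcomp := hd.comp ![x, y] (hΦ ![x, y])
    rw [planeMap_comp, show (Ψ ∘ H.symm) ∘ Φ = Ψ from funext hψΦ] at hcomp
    have e := hcomp.gradMat_eq.symm.trans (hΨ ![x, y]).gradMat_eq
    have hne : 1 + g₁ y * c₁ x ≠ 0 := (hpos x y).ne'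
    have e' := e.trans (genGrad_mul hne (g y * c₂ x) (g₂ y * c x)).symm
    have hu : IsUnit (J ![x, y]) := by
      rw [Matrix.isUnit_iff_isUnit_det, ← det_planeMap]
      exact (hdet _).isUnit
    exact hu.mul_left_injective e'

/-! ### Rectangles -/

/-- The product of two subsets of the line, as a subset of the plane. -/
def rect (s t : Set ℝ) : Set (Fin 2 → ℝ) := {z | z 0 ∈ s ∧ z 1 ∈ t}

theorem rect_eq_pi (s t : Set ℝ) : rect s t = Set.univ.pi ![s, t] := by
  ext z
  simp [rect, Set.mem_pi, Fin.forall_fin_two]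

theorem volume_real_rect (s t : Set ℝ) :
    volume.real (rect s t) = volume.real s * volume.real t := by
  rw [rect_eq_pi, measureReal_def, volume_pi_pi, ENNReal.toReal_prod, Fin.prod_univ_two]
  rfl

theorem measurableSet_rect {s t : Set ℝ} (hs : MeasurableSet s) (ht : MeasurableSet t) :
    MeasurableSet (rect s t) :=
  ((measurable_pi_apply 0) hs).inter ((measurable_pi_apply 1) ht)

theorem isOpen_rect {s t : Set ℝ} (hs : IsOpen s) (ht : IsOpen t) : IsOpen (rect s t) :=
  (hs.preimage (continuous_apply 0)).inter (ht.preimage (continuous_apply 1))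

theorem isCompact_rect {s t : Set ℝ} (hs : IsCompact s) (ht : IsCompact t) :
    IsCompact (rect s t) := by
  rw [rect_eq_pi]
  refine isCompact_univ_pi fun i => ?_
  fin_cases i
  exacts [hs, ht]

theorem rect_subset_rect {s t s' t' : Set ℝ} (hs : s ⊆ s') (ht : t ⊆ t') :
    rect s t ⊆ rect s' t' := fun _ hz => ⟨hs hz.1, ht hz.2⟩

theorem volume_real_preimage_planeMap {B : Mat} (hB : B.det = 1) (s : Set (Fin 2 → ℝ)) :
    volume.real (planeMap B ⁻¹' s) = volume.real s := by
  have h : LinearMap.det (planeMap B : (Fin 2 → ℝ) →ₗ[ℝ] (Fin 2 → ℝ)) = 1 := by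
    have := det_planeMap B
    rwa [hB] at this
  have h' := Measure.addHaar_preimage_linearMap volume
    (f := (planeMap B : (Fin 2 → ℝ) →ₗ[ℝ] (Fin 2 → ℝ))) (by rw [h]; exact one_ne_zero) s
  rw [h, inv_one, abs_one, ENNReal.ofReal_one, one_mul] at h'
  rw [measureReal_def, measureReal_def]
  exact congrArg _ h'

theorem isCompact_preimage_planeMap {B : Mat} (hB : B.det = 1) {s : Set (Fin 2 → ℝ)}
    (hs : IsCompact s) : IsCompact (planeMap B ⁻¹' s) := by
  have h : (planeMap B).det ≠ 0 := by rw [det_planeMap, hB]; exact one_ne_zero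
  exact ((planeMap B).toContinuousLinearEquivOfDetNeZero h).toHomeomorph.isCompact_preimage.2 hs

/-! ### Quasiconvexity along shears -/

/-- `w` is locally bounded above on the matrices of determinant one. -/
def LocBddAboveOnDetOne (w : Mat → EReal) : Prop :=
  ∀ F : Mat, F.det = 1 → ∃ U ∈ 𝓝 F, ∃ M : ℝ, ∀ G ∈ U, G.det = 1 → w G ≤ (M : EReal)

theorem continuousAt_genGrad (d : ℝ) :
    ContinuousAt (fun q : (ℝ × ℝ) × ℝ => genGrad q.1.1 q.1.2 q.2) ((0, 0), d) := by
  have ha : ContinuousAt (fun q : (ℝ × ℝ) × ℝ => 1 + q.1.1) ((0, 0), d) := by fun_prop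
  have hc : ContinuousAt (fun q : (ℝ × ℝ) × ℝ => q.1.2) ((0, 0), d) := by fun_prop
  have hd : ContinuousAt (fun q : (ℝ × ℝ) × ℝ => q.2) ((0, 0), d) := by fun_prop
  have hne : (1 : ℝ) + (0 : ℝ) ≠ 0 := by norm_num
  refine continuousAt_pi.2 fun i => continuousAt_pi.2 fun j => ?_
  fin_cases i <;> fin_cases j
  · exact ha.sub ((hd.mul hc).div ha hne)
  · exact hd.div ha hne
  · exact hc.neg.div ha hne
  · exact continuousAt_const.div ha hne

theorem LocBddAboveOnDetOne.exists_bound_nhds {w : Mat → EReal} (hw : LocBddAboveOnDetOne w)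
    {A B : Mat} (hA : A.det = 1) (hB : B.det = 1) (d : ℝ) :
    ∃ M : ℝ, ∀ᶠ q : (ℝ × ℝ) × ℝ in 𝓝 ((0, 0), d),
      w (A * genGrad q.1.1 q.1.2 q.2 * B) ≤ (M : EReal) := by
  have hdet : ∀ a c d : ℝ, 1 + a ≠ 0 → (A * genGrad a c d * B).det = 1 := fun a c d h => by
    rw [Matrix.det_mul, Matrix.det_mul, hA, hB, det_genGrad h, one_mul, one_mul]
  obtain ⟨U, hU, M, hM⟩ := hw (A * genGrad 0 0 d * B) (hdet 0 0 d (by norm_num))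
  refine ⟨M, ?_⟩
  have hcont : ContinuousAt (fun q : (ℝ × ℝ) × ℝ => A * genGrad q.1.1 q.1.2 q.2 * B)
      ((0, 0), d) := (continuousAt_const.mul (continuousAt_genGrad d)).mul continuousAt_const
  have hne : ∀ᶠ q : (ℝ × ℝ) × ℝ in 𝓝 ((0, 0), d), 1 + q.1.1 ≠ 0 :=
    ContinuousAt.eventually_ne (g := fun q : (ℝ × ℝ) × ℝ => 1 + q.1.1) (by fun_prop) (by norm_num)
  filter_upwards [hcont.eventually_mem hU, hne] with q hq hq'
  exact hM _ hq (hdet _ _ _ hq')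

/-- Along the test maps `a` and `c` are small, but `d` runs through a whole interval. Compactness of
`[-T, T]` makes the local bounds near `(0, 0, d)` uniform in `d`. -/
theorem LocBddAboveOnDetOne.exists_bound {w : Mat → EReal} (hw : LocBddAboveOnDetOne w) {A B : Mat}
    (hA : A.det = 1) (hB : B.det = 1) (T : ℝ) :
    ∃ η : ℝ, 0 < η ∧ η ≤ 1 / 4 ∧ ∃ M : ℝ, ∀ a c d : ℝ, |a| ≤ η → |c| ≤ η → |d| ≤ T →
      w (A * genGrad a c d * B) ≤ (M : EReal) := by
  have key : ∃ M : ℝ, ∀ᶠ p in 𝓝 ((0, 0) : ℝ × ℝ), ∀ d ∈ Set.Icc (-T) T,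
      w (A * genGrad p.1 p.2 d * B) ≤ (M : EReal) := by
    have hT : IsCompact (Set.Icc (-T) T) := isCompact_Icc
    let P : Set ℝ → Prop := fun S => ∃ M : ℝ, ∀ᶠ p in 𝓝 ((0, 0) : ℝ × ℝ), ∀ d ∈ S,
      w (A * genGrad p.1 p.2 d * B) ≤ (M : EReal)
    change P (Set.Icc (-T) T)
    refine IsCompact.induction_on (p := P) hT ?_ ?_ ?_ ?_
    · exact ⟨0, Filter.Eventually.of_forall fun _ _ h => h.elim⟩
    · rintro s t hst ⟨M, hM⟩
      exact ⟨M, hM.mono fun p h d hd => h d (hst hd)⟩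
    · rintro s t ⟨M, hM⟩ ⟨N, hN⟩
      refine ⟨max M N, (hM.and hN).mono fun p h d hd => ?_⟩
      rcases hd with hd | hd
      · exact (h.1 d hd).trans (EReal.coe_le_coe_iff.2 (le_max_left _ _))
      · exact (h.2 d hd).trans (EReal.coe_le_coe_iff.2 (le_max_right _ _))
    · intro d _
      obtain ⟨M, hM⟩ := hw.exists_bound_nhds hA hB d
      rw [nhds_prod_eq, Filter.eventually_prod_iff] at hM
      obtain ⟨p₁, h₁, p₂, h₂, h⟩ := hM
      exact ⟨{e | p₂ e}, mem_nhdsWithin_of_mem_nhds h₂, M, h₁.mono fun p hp e he => h hp he⟩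
  obtain ⟨M, hM⟩ := key
  obtain ⟨ε, hε, hball⟩ := Metric.mem_nhds_iff.1 hM
  refine ⟨min (ε / 2) (1 / 4), by positivity, min_le_right _ _, M, fun a c d ha hc hd => ?_⟩
  have hlt : min (ε / 2) (1 / 4) < ε := (min_le_left _ _).trans_lt (by linarith)
  have hmem : (a, c) ∈ Metric.ball ((0, 0) : ℝ × ℝ) ε := by
    rw [Metric.mem_ball, Prod.dist_eq, max_lt_iff, Real.dist_eq, Real.dist_eq, sub_zero, sub_zero]
    exact ⟨ha.trans_lt hlt, hc.trans_lt hlt⟩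
  exact hball hmem d (abs_le.1 hd)

/-- An area-preserving map that agrees with the identity off a rectangle and whose gradient is
mostly one of two shears, and elsewhere close to a shear of bounded amount. -/
theorem exists_laminate (α : ℝ) {r κ η : ℝ} (hr0 : 0 < r) (hr1 : r < 1) (hκ0 : 0 < κ)
    (hκ1 : κ < 1) (hη0 : 0 < η) (hη1 : η ≤ 1 / 4) :
    ∃ L : ℝ, 0 < L ∧ ∃ ψ : (Fin 2 → ℝ) → (Fin 2 → ℝ), ContDiff ℝ ∞ ψ ∧
      (∀ z, z ∉ rect (Set.Icc (-((1 + κ) / 2 * L)) ((1 + κ) / 2 * L))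
        (Set.Icc (-((1 + κ) / 2)) ((1 + κ) / 2)) → ψ z = z) ∧
      (∀ z, ∃ a c d, |a| ≤ η ∧ |c| ≤ η ∧ |d| ≤ |α| * (1 + 1 / r) ∧ gradMat ψ z = genGrad a c d) ∧
      (∀ z, |z 0| < κ * L → r ≤ |z 1| → |z 1| ≤ κ → gradMat ψ z = shear α) ∧
      ∀ z, |z 0| < κ * L → |z 1| ≤ κ * r → gradMat ψ z = shear (α * (1 - 1 / r)) := by
  obtain ⟨g, g₁, g₂, hg, hg₁, hgs, hg₁s, hgz, hg₂, hβ, hα⟩ := exists_profile α hr0 hr1 hκ0 hκ1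
  obtain ⟨C, hC, hgC⟩ := exists_abs_le_of_eq_zero hgs.continuous fun y hy => (hgz y hy).1
  obtain ⟨C₁, hC₁, hg₁C⟩ := exists_abs_le_of_eq_zero hg₁s.continuous fun y hy => (hgz y hy).2
  obtain ⟨L, hL, c, c₁, c₂, hc, hc₁, hcs, hc₁s, hcz, hc1, hcb⟩ :=
    -- This choice brings `g₁ * c₁` and `g * c₂`, the entries `a` and `c` of the gradient, below
    -- `η`.
    exists_cutoff (η := η / (C + C₁)) hκ0 hκ1 (by positivity)
  have hsmall : ∀ {u v K : ℝ}, |u| ≤ K → K ≤ C + C₁ → |v| ≤ η / (C + C₁) → |u * v| ≤ η := by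
    intro u v K hu hK hv
    rw [abs_mul]
    calc |u| * |v| ≤ (C + C₁) * (η / (C + C₁)) :=
          mul_le_mul (hu.trans hK) hv (abs_nonneg _) (by positivity)
      _ = η := by field_simp
  have ha : ∀ x y, |g₁ y * c₁ x| ≤ η := fun x y => hsmall (hg₁C y) (by linarith) (hcb x).2.1
  have hcc : ∀ x y, |g y * c₂ x| ≤ η := fun x y => hsmall (hgC y) (by linarith) (hcb x).2.2
  have hd : ∀ x y, |g₂ y * c x| ≤ |α| * (1 + 1 / r) := fun x y => by
    rw [abs_mul]
    exact (mul_le_of_le_one_right (abs_nonneg _) (hcb x).1).trans (hg₂ y)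
  obtain ⟨ψ, hψs, hsurj, hψ⟩ := exists_areaPreserving hg hg₁ hgs hg₁s hc hc₁ hcs hc₁s
    (fun x y => (ha x y).trans hη1) (fun x y => (hcc x y).trans hη1)
  have hvec : ∀ z : Fin 2 → ℝ, ![z 0, z 1] = z := fun z => by
    ext i; fin_cases i <;> rfl
  have hgradc : ∀ z, |z 0| < κ * L → gradMat ψ z = shear (g₂ (z 1)) := by
    intro z hz
    obtain ⟨h1, h2, h3⟩ := hc1 _ hz
    have h4 := (hψ (z 0) (z 1)).2
    rwa [h1, h2, h3, mul_zero, mul_zero, mul_one, add_zero, genGrad_zero_zero, hvec] at h4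
  refine ⟨L, hL, ψ, hψs, fun z hz => ?_, fun z => ?_, fun z h1 h2 h3 => ?_, fun z h1 h2 => ?_⟩
  -- Off the rectangle one factor of the generating function vanishes with its first derivative, so
  -- the mixed coordinates of `z` are those of `z` itself and `ψ` fixes it.
  · by_cases h0 : (1 + κ) / 2 * L ≤ |z 0|
    · obtain ⟨h1, h2⟩ := hcz _ h0
      have h3 := (hψ (z 0) (z 1)).1
      rwa [h1, h2, mul_zero, mul_zero, add_zero, add_zero, hvec] at h3
    by_cases h0' : (1 + κ) / 2 ≤ |z 1|
    · obtain ⟨h1, h2⟩ := hgz _ h0'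
      have h3 := (hψ (z 0) (z 1)).1
      rwa [h1, h2, zero_mul, zero_mul, add_zero, add_zero, hvec] at h3
    · exact absurd ⟨abs_le.1 (not_le.1 h0).le, abs_le.1 (not_le.1 h0').le⟩ hz
  · obtain ⟨y, hy⟩ := hsurj z
    refine ⟨_, _, _, ha (z 0) y, hcc (z 0) y, hd (z 0) y, ?_⟩
    conv_lhs => rw [hy]
    exact (hψ (z 0) y).2
  · rw [hgradc z h1, hα _ h2 h3]
  · rw [hgradc z h1, hβ _ h2]

/-- Adding this displacement to the linear map `A * B` gives `z ↦ A ψ(B z)`. It carries the laminate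
over to the line `A * shear t * B`. -/
theorem add_gradMat_planeMap_conj {ψ : (Fin 2 → ℝ) → (Fin 2 → ℝ)} (hψ : ContDiff ℝ ∞ ψ)
    (A B : Mat) (z : Fin 2 → ℝ) :
    A * B + gradMat (fun z => planeMap A (ψ (planeMap B z) - planeMap B z)) z =
      A * gradMat ψ (planeMap B z) * B := by
  have h1 := (hasFDerivAt_planeMap_gradMat
    ((hψ.differentiable (by simp)) (planeMap B z))).comp z (planeMap B).hasFDerivAt
  have h2 := (planeMap A).hasFDerivAt.comp z (h1.sub (planeMap B).hasFDerivAt)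
  have h3 : gradMat (fun z => planeMap A (ψ (planeMap B z) - planeMap B z)) z =
      A * (gradMat ψ (planeMap B z) * B - B) := by
    refine HasFDerivAt.gradMat_eq ?_
    convert! h2 using 1
    rw [planeMap_comp, ← planeMap_comp A]
    congr 1
    ext1 v
    simp [planeMap_apply, Matrix.sub_mulVec]
  rw [h3, Matrix.mul_sub, Matrix.mul_assoc]
  abel

/-- The laminate is tested on the preimage under `B` of `(-L, L) × (-1, 1)`, of area `4L`. The
fractions `κ(κ - r)` and `κ · κr` of it carry the two shears; on the rest `w` is at most `M`. -/
theorem QuasiconvexIneq.shear_le_of_plateau {w : Mat → EReal} (hq : QuasiconvexIneq w) {A B : Mat}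
    (hB : B.det = 1) {k : ℝ → ℝ} (hk : ∀ t, w (A * shear t * B) = (k t : EReal))
    {α r κ η M : ℝ} (hr0 : 0 < r) (hr1 : r < 1) (hκr : r < κ) (hκ1 : κ < 1) (hη0 : 0 < η)
    (hη1 : η ≤ 1 / 4)
    (hM : ∀ a c d : ℝ, |a| ≤ η → |c| ≤ η → |d| ≤ |α| * (1 + 1 / r) →
      w (A * genGrad a c d * B) ≤ (M : EReal)) :
    k 0 ≤ M + (k α - M) * (κ * (κ - r)) + (k (α * (1 - 1 / r)) - M) * (κ * (κ * r)) := by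
  have hκ0 : 0 < κ := hr0.trans hκr
  obtain ⟨L, hL, ψ, hψs, hid, hgb, hα, hβ⟩ := exists_laminate α hr0 hr1 hκ0 hκ1 hη0 hη1
  set ρ := (1 + κ) / 2
  have hρ1 : ρ < 1 := by simp only [ρ]; linarith
  have hρ0 : 0 < ρ := by simp only [ρ]; linarith
  have hgrad : ∀ z, w (A * gradMat ψ z * B) ≤ (M : EReal) := by
    intro z
    obtain ⟨a, c, d, ha, hc, hd, h⟩ := hgb z
    rw [h]
    exact hM a c d ha hc hd
  let ϑ : (Fin 2 → ℝ) → (Fin 2 → ℝ) := fun z => planeMap A (ψ (planeMap B z) - planeMap B z)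
  have hϑs : ContDiff ℝ ∞ ϑ :=
    (planeMap A).contDiff.comp ((hψs.comp (planeMap B).contDiff).sub (planeMap B).contDiff)
  let K := planeMap B ⁻¹' rect (Set.Icc (-(ρ * L)) (ρ * L)) (Set.Icc (-ρ) ρ)
  let Ω := planeMap B ⁻¹' rect (Set.Ioo (-L) L) (Set.Ioo (-1) 1)
  have hKc : IsCompact K :=
    isCompact_preimage_planeMap hB (isCompact_rect isCompact_Icc isCompact_Icc)
  have hϑK : tsupport ϑ ⊆ K := by
    refine closure_minimal (fun z hz => ?_) hKc.isClosed
    by_contra hzK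
    exact hz (by simp only [ϑ]; rw [hid _ hzK, sub_self, map_zero])
  have hKΩ : K ⊆ Ω := Set.preimage_mono <| rect_subset_rect
    (Set.Icc_subset_Ioo (by nlinarith) (by nlinarith)) (Set.Icc_subset_Ioo (by linarith) hρ1)
  have hΩo : IsOpen Ω := (isOpen_rect isOpen_Ioo isOpen_Ioo).preimage (planeMap B).continuous
  have hΩb : Bornology.IsBounded Ω :=
    (isCompact_preimage_planeMap hB (isCompact_rect (isCompact_Icc (a := -L) (b := L))
      (isCompact_Icc (a := -1) (b := 1)))).isBounded.subset
      (Set.preimage_mono (rect_subset_rect Set.Ioo_subset_Icc_self Set.Ioo_subset_Icc_self))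
  let Rα := rect (Set.Ioo (-(κ * L)) (κ * L)) (Set.Icc (-κ) κ \ Set.Icc (-r) r)
  let Rβ := rect (Set.Ioo (-(κ * L)) (κ * L)) (Set.Icc (-(κ * r)) (κ * r))
  have hRα : MeasurableSet (planeMap B ⁻¹' Rα) := (planeMap B).continuous.measurable
    (measurableSet_rect measurableSet_Ioo (measurableSet_Icc.diff measurableSet_Icc))
  have hRβ : MeasurableSet (planeMap B ⁻¹' Rβ) := (planeMap B).continuous.measurable
    (measurableSet_rect measurableSet_Ioo measurableSet_Icc)
  let β := α * (1 - 1 / r)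
  let s : (Fin 2 → ℝ) → ℝ := fun z => M + (planeMap B ⁻¹' Rα).indicator (fun _ => k α - M) z +
    (planeMap B ⁻¹' Rβ).indicator (fun _ => k β - M) z
  have hle : ∀ z, w (A * B + gradMat ϑ z) ≤ (s z : EReal) := by
    intro z
    rw [add_gradMat_planeMap_conj hψs]
    by_cases h1 : z ∈ planeMap B ⁻¹' Rα
    · have h2 : z ∉ planeMap B ⁻¹' Rβ := fun h => h1.2.2
        ⟨by nlinarith [h.2.1], by nlinarith [h.2.2]⟩
      have h3 : s z = k α := by
        simp only [s]
        rw [Set.indicator_of_mem h1, Set.indicator_of_notMem h2]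
        ring
      rw [h3, hα _ (abs_lt.2 h1.1) ?_ (abs_le.2 h1.2.1), hk]
      by_contra hlt
      exact h1.2.2 (abs_le.1 (not_le.1 hlt).le)
    by_cases h2 : z ∈ planeMap B ⁻¹' Rβ
    · have h3 : s z = k β := by
        simp only [s]
        rw [Set.indicator_of_mem h2, Set.indicator_of_notMem h1]
        ring
      rw [h3, hβ _ (abs_lt.2 h2.1) (abs_le.2 h2.2), hk]
    · have h3 : s z = M := by
        simp only [s]
        rw [Set.indicator_of_notMem h2, Set.indicator_of_notMem h1]
        ring
      rw [h3]
      exact hgrad _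
  have hmain := (hq (A * B) Ω hΩo hΩb ϑ hϑs (hKc.of_isClosed_subset (isClosed_tsupport _) hϑK)
    (hϑK.trans hKΩ)).trans (eintegral_mono hΩo.measurableSet fun z _ => hle z)
  have hfin : volume Ω ≠ ⊤ := hΩb.measure_lt_top.ne
  have hi : ∀ (R : Set (Fin 2 → ℝ)) (x : ℝ), MeasurableSet R →
      IntegrableOn (R.indicator fun _ => x) Ω := fun R x hR =>
    (integrableOn_const hfin).indicator hR
  have hiM : IntegrableOn (fun _ => M) Ω := integrableOn_const hfin
  have hiα := hi _ (k α - M) hRα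
  have hiβ := hi _ (k β - M) hRβ
  have h0 := hk 0
  rw [shear_zero, mul_one] at h0
  have hsub : κ * L < L := by nlinarith
  have hRαΩ : planeMap B ⁻¹' Rα ⊆ Ω := Set.preimage_mono <| rect_subset_rect
    (Set.Ioo_subset_Ioo (by linarith) hsub.le)
    (Set.sdiff_subset.trans (Set.Icc_subset_Ioo (by linarith) hκ1))
  have hRβΩ : planeMap B ⁻¹' Rβ ⊆ Ω := Set.preimage_mono <| rect_subset_rect
    (Set.Ioo_subset_Ioo (by linarith) hsub.le) (Set.Icc_subset_Ioo (by nlinarith) (by nlinarith))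
  rw [eintegral_coe (f := s) ((hiM.add hiα).add hiβ), h0,
    ← EReal.coe_ennreal_toReal hfin, ← EReal.coe_mul, EReal.coe_le_coe_iff] at hmain
  have hint : ∫ z in Ω, s z = volume.real Ω * M + volume.real (planeMap B ⁻¹' Rα) * (k α - M) +
      volume.real (planeMap B ⁻¹' Rβ) * (k β - M) := by
    have e1 : ∫ z in Ω, s z = (∫ z in Ω, (M + (planeMap B ⁻¹' Rα).indicator (fun _ => k α - M) z)) +
      ∫ z in Ω, (planeMap B ⁻¹' Rβ).indicator (fun _ => k β - M) z :=
      integral_add (hiM.add hiα) hiβ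
    rw [e1, integral_add hiM hiα, setIntegral_const,
      setIntegral_indicator hRα, setIntegral_indicator hRβ, setIntegral_const, setIntegral_const,
      Set.inter_eq_self_of_subset_right hRαΩ, Set.inter_eq_self_of_subset_right hRβΩ]
    simp only [smul_eq_mul]
  have vΩ : volume.real Ω = 4 * L := by
    rw [volume_real_preimage_planeMap hB, volume_real_rect, Real.volume_real_Ioo_of_le (by linarith),
      Real.volume_real_Ioo_of_le (by norm_num)]
    ring
  have vα : volume.real (planeMap B ⁻¹' Rα) = 4 * L * (κ * (κ - r)) := by
    rw [volume_real_preimage_planeMap hB, volume_real_rect,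
      Real.volume_real_Ioo_of_le (by nlinarith),
      measureReal_sdiff (Set.Icc_subset_Icc (by linarith) hκr.le) measurableSet_Icc
        measure_Icc_lt_top.ne,
      Real.volume_real_Icc_of_le (by linarith), Real.volume_real_Icc_of_le (by linarith)]
    ring
  have vβ : volume.real (planeMap B ⁻¹' Rβ) = 4 * L * (κ * (κ * r)) := by
    rw [volume_real_preimage_planeMap hB, volume_real_rect,
      Real.volume_real_Ioo_of_le (by nlinarith), Real.volume_real_Icc_of_le (by nlinarith)]
    ring
  rw [hint, vα, vβ, ← measureReal_def, vΩ] at hmain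
  refine le_of_mul_le_mul_left (a := 4 * L) ?_ (by positivity)
  linarith

/-- A function that satisfies the quasiconvexity inequality is convex along shears if it is locally
bounded above on the matrices of determinant one. -/
theorem QuasiconvexIneq.shear_le {w : Mat → EReal} (hq : QuasiconvexIneq w)
    (hw : LocBddAboveOnDetOne w) {A B : Mat} (hA : A.det = 1) (hB : B.det = 1) {k : ℝ → ℝ}
    (hk : ∀ t, w (A * shear t * B) = (k t : EReal)) (α : ℝ) {r : ℝ} (hr0 : 0 < r) (hr1 : r < 1) :
    k 0 ≤ (1 - r) * k α + r * k (α * (1 - 1 / r)) := by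
  obtain ⟨η, hη0, hη1, M, hM⟩ := hw.exists_bound hA hB (|α| * (1 + 1 / r))
  -- Since `M` does not depend on `κ`, its total weight tends to zero as `κ → 1`.
  have hlim : Filter.Tendsto (fun κ : ℝ => M + (k α - M) * (κ * (κ - r)) +
      (k (α * (1 - 1 / r)) - M) * (κ * (κ * r))) (𝓝[<] 1)
      (𝓝 (M + (k α - M) * (1 * (1 - r)) + (k (α * (1 - 1 / r)) - M) * (1 * (1 * r)))) := by
    refine (Continuous.tendsto ?_ 1).mono_left nhdsWithin_le_nhds
    fun_prop
  refine (ge_of_tendsto hlim ?_).trans (le_of_eq (by ring))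
  filter_upwards [Ioo_mem_nhdsLT hr1] with κ hκ
  exact hq.shear_le_of_plateau hB hk hr0 hr1 hκ.1 hκ.2 hη0 hη1 hM

theorem QuasiconvexIneq.convexOn_shear {w : Mat → EReal} (hq : QuasiconvexIneq w)
    (hw : LocBddAboveOnDetOne w) {A B : Mat} (hA : A.det = 1) (hB : B.det = 1) {k : ℝ → ℝ}
    (hk : ∀ t, w (A * shear t * B) = (k t : EReal)) : ConvexOn ℝ Set.univ k := by
  refine ⟨convex_univ, fun x _ y _ a b ha hb hab => ?_⟩
  rcases ha.eq_or_lt with rfl | ha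
  · simp [show b = 1 by linarith]
  rcases hb.eq_or_lt with rfl | hb
  · simp [show a = 1 by linarith]
  simp only [smul_eq_mul]
  set s := a * x + b * y with hs
  -- Recentre at `s` and take `α = x - s`, `r = b`; then `α * (1 - 1 / r) = y - s`.
  have h := hq.shear_le hw (A := A * shear s) (by rw [Matrix.det_mul, hA, det_shear, one_mul]) hB
    (k := fun t => k (s + t)) (fun t => by rw [Matrix.mul_assoc A, shear_mul_shear, hk])
    (x - s) hb (by linarith)
  have e1 : s + (x - s) = x := by ring
  have e2 : s + (x - s) * (1 - 1 / b) = y := by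
    rw [hs]
    obtain rfl : a = 1 - b := by linarith
    field_simp
    ring
  simp only [add_zero, e1, e2] at h
  rwa [show 1 - b = a by linarith] at h

/-! ### Representation of isotropic functions -/

/-- The simple shear as an element of the special linear group. -/
def shearSL (t : ℝ) : SL(2, ℝ) := ⟨shear t, det_shear t⟩

/-- The rotation as an element of the special linear group. -/
noncomputable def rotSL (θ : ℝ) : SL(2, ℝ) := ⟨rot θ, det_rot θ⟩

theorem radius_rot_mul_sq (θ : ℝ) (F : Mat) : radius (rot θ * F) ^ 2 = radius F ^ 2 := by
  rw [radius_sq, radius_sq]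
  simp only [rot, Matrix.mul_apply, Fin.sum_univ_two, Matrix.of_apply, Matrix.cons_val_zero,
    Matrix.cons_val_one]
  linear_combination ((F 0 0 - F 1 1) ^ 2 + (F 0 1 + F 1 0) ^ 2) * Real.cos_sq_add_sin_sq θ

theorem radius_mul_rot_sq (θ : ℝ) (F : Mat) : radius (F * rot θ) ^ 2 = radius F ^ 2 := by
  rw [radius_sq, radius_sq]
  simp only [rot, Matrix.mul_apply, Fin.sum_univ_two, Matrix.of_apply, Matrix.cons_val_zero,
    Matrix.cons_val_one]
  linear_combination ((F 0 0 - F 1 1) ^ 2 + (F 0 1 + F 1 0) ^ 2) * Real.cos_sq_add_sin_sq θ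

theorem apply_eq_apply_shearSL {W : SL(2, ℝ) → ℝ} (hobj : IsObjective W) (hiso : IsIsotropic W)
    (F : SL(2, ℝ)) {s : ℝ} (hs : radius (F : Mat) ^ 2 = s ^ 2) : W F = W (shearSL s) := by
  obtain ⟨a, b, h⟩ := exists_eq_rot_mul_shear_mul_rot F.2 hs
  have e : F = rotSL a * shearSL s * rotSL b := Subtype.ext h
  rw [e, hiso _ _ (rot_mem b), hobj _ _ (rot_mem a)]

theorem represents_shearSL {W : SL(2, ℝ) → ℝ} (hobj : IsObjective W) (hiso : IsIsotropic W) :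
    Represents (fun t => W (shearSL t)) W := fun F _ _ h =>
  apply_eq_apply_shearSL hobj hiso F (sub_sq_of_hasSingularValues F.2 h).symm

theorem Represents.apply_eq {φ : ℝ → ℝ} {W : SL(2, ℝ) → ℝ} (h : Represents φ W) (F : SL(2, ℝ))
    {s : ℝ} (hs : radius (F : Mat) ^ 2 = s ^ 2) : W F = φ s := by
  have h1 := hasSingularValues_singularValues (F : Mat)
  have h2 := sub_sq_of_hasSingularValues F.2 h1
  rw [hs, sq_eq_sq_iff_eq_or_eq_neg] at h2
  rcases h2 with h2 | h2
  · rw [h F _ _ h1, h2]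
  · rw [h F _ _ h1.symm, ← neg_sub, h2, neg_neg]

theorem Represents.apply_shearSL {φ : ℝ → ℝ} {W : SL(2, ℝ) → ℝ} (h : Represents φ W) (t : ℝ) :
    W (shearSL t) = φ t :=
  h.apply_eq _ (radius_shear_sq t)

theorem Represents.neg {φ : ℝ → ℝ} {W : SL(2, ℝ) → ℝ} (h : Represents φ W) (t : ℝ) :
    φ (-t) = φ t := by
  rw [← h.apply_shearSL t]
  exact (h.apply_eq (shearSL t) (by rw [neg_sq]; exact radius_shear_sq t)).symm

theorem Represents.bddBelow {φ : ℝ → ℝ} {W : SL(2, ℝ) → ℝ} (h : Represents φ W)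
    (hW : BddBelow (Set.range W)) : BddBelow (Set.range φ) := by
  refine hW.mono ?_
  rintro _ ⟨t, rfl⟩
  exact ⟨shearSL t, h.apply_shearSL t⟩

/-- The singular values of `shear t` differ by `±t` and may be taken in either order, so `W (shear
t)` prescribes `φ` at every real `t`, negative ones included. -/
theorem existsUnique_represents {W : SL(2, ℝ) → ℝ} (hobj : IsObjective W) (hiso : IsIsotropic W) :
    ∃! φ : ℝ → ℝ, Represents φ W :=
  ⟨_, represents_shearSL hobj hiso, fun _ hφ => funext fun t => (hφ.apply_shearSL t).symm⟩

theorem extendTop_coe (W : SL(2, ℝ) → ℝ) (F : SL(2, ℝ)) : extendTop W F = (W F : EReal) := by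
  rw [extendTop, dif_pos F.2]
  rfl

theorem Represents.conformalExtension_eq {φ : ℝ → ℝ} {W : SL(2, ℝ) → ℝ} (h : Represents φ W)
    (F : SL(2, ℝ)) : ((W F : ℝ) : EReal) = conformalExtension φ (F : Mat) := by
  rw [h.apply_eq F rfl, conformalExtension]

theorem Represents.conformalExtension_le {φ : ℝ → ℝ} {W : SL(2, ℝ) → ℝ} (h : Represents φ W)
    (F : Mat) : conformalExtension φ F ≤ extendTop W F := by
  by_cases hF : F.det = 1
  · have := h.conformalExtension_eq ⟨F, hF⟩
    exact (this.symm.trans (extendTop_coe W ⟨F, hF⟩).symm).le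
  · rw [extendTop, dif_neg hF]
    exact le_top

/-! ### Convexity along shears -/

/-- Convexity along the lines of shears in `SL(2)`. -/
def IsShearConvex (w : Mat → EReal) : Prop :=
  ∀ A B : Mat, A.det = 1 → B.det = 1 → ∀ x y t : ℝ, 0 < t → t < 1 → x ≠ y →
    w (A * shear ((1 - t) * x + t * y) * B) ≤
      ((1 - t : ℝ) : EReal) * w (A * shear x * B) + (t : EReal) * w (A * shear y * B)

theorem mul_shear_combination_mul (A B : Mat) (x y t : ℝ) :
    A * shear ((1 - t) * x + t * y) * B =
      (1 - t) • (A * shear x * B) + t • (A * shear y * B) := by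
  have e : shear ((1 - t) * x + t * y) = (1 - t) • shear x + t • shear y := by
    ext i j
    fin_cases i <;> fin_cases j <;> simp [shear]
  rw [e, Matrix.mul_add, Matrix.add_mul, Matrix.mul_smul, Matrix.mul_smul, Matrix.smul_mul,
    Matrix.smul_mul]

theorem det_mul_shear_mul {A B : Mat} (hA : A.det = 1) (hB : B.det = 1) (t : ℝ) :
    (A * shear t * B).det = 1 := by
  rw [Matrix.det_mul, Matrix.det_mul, hA, hB, det_shear, one_mul, one_mul]

/-- The determinant is constantly one along the line, so `(F, det F)` moves affinely. -/
theorem IsPolyconvex.isShearConvex {w : Mat → EReal} (h : IsPolyconvex w) : IsShearConvex w := by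
  obtain ⟨P, hP, hw⟩ := h
  intro A B hA hB x y t h0 h1 _
  have := hP.2 (A * shear x * B, 1) (A * shear y * B, 1) t h0.le h1.le
  simp only [hw, det_mul_shear_mul hA hB]
  rw [mul_shear_combination_mul]
  convert! this using 2
  simp

theorem IsPolyconvex.neverBot {w : Mat → EReal} (h : IsPolyconvex w) : NeverBot w := by
  obtain ⟨P, hP, hw⟩ := h
  intro F
  rw [hw]
  exact hP.1 _

theorem rank_mul_shear_sub_mul {A B : Mat} (hA : A.det = 1) (hB : B.det = 1) {x y : ℝ}
    (hxy : x ≠ y) : (A * shear y * B - A * shear x * B).rank = 1 := by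
  rw [← Matrix.sub_mul, ← Matrix.mul_sub,
    Matrix.rank_mul_eq_left_of_isUnit_det _ _ (by rw [hB]; exact isUnit_one),
    Matrix.rank_mul_eq_right_of_isUnit_det _ _ (by rw [hA]; exact isUnit_one)]
  have e : shear y - shear x = Matrix.vecMulVec ![y - x, 0] ![0, 1] := by
    ext i j
    fin_cases i <;> fin_cases j <;> simp [shear, Matrix.vecMulVec]
  refine le_antisymm (e ▸ Matrix.rank_vecMulVec_le _ _) (Nat.one_le_iff_ne_zero.2 fun h0 => ?_)
  have h1 := LinearMap.range_eq_bot.1 (Submodule.finrank_eq_zero.1 h0)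
  have h2 := congrFun (LinearMap.congr_fun h1 ![0, 1]) 0
  simp [shear] at h2
  exact hxy (by linarith)

theorem IsRankOneConvex.isShearConvex {w : Mat → EReal} (h : IsRankOneConvex w) :
    IsShearConvex w := by
  intro A B hA hB x y t h0 h1 hxy
  have := h.2 (A * shear x * B) _ (rank_mul_shear_sub_mul hA hB hxy) t h0.le h1.le
  rwa [add_sub_cancel, ← mul_shear_combination_mul] at this

/-- The upper bound common to all classes: the line of shears through `F`, with the rotations of its
decomposition, meets `F` at parameter `radius F`, and on it `w` is real, convex and below `φ`. -/
theorem Represents.le_biconjugate_of_convexOn {φ : ℝ → ℝ} {W : SL(2, ℝ) → ℝ} (h : Represents φ W)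
    {w : Mat → EReal} (hbot : NeverBot w) (hle : ∀ F, w F ≤ extendTop W F)
    (hc : ∀ A B : Mat, A.det = 1 → B.det = 1 → ∀ k : ℝ → ℝ,
      (∀ t, w (A * shear t * B) = (k t : EReal)) → ConvexOn ℝ Set.univ k) (F : SL(2, ℝ)) :
    w F ≤ biconjugate φ (radius (F : Mat)) := by
  obtain ⟨a, b, hF⟩ := exists_eq_rot_mul_shear_mul_rot F.2 (rfl : radius (F : Mat) ^ 2 = _)
  have hφ : ∀ t, w (rot a * shear t * rot b) ≤ (φ t : EReal) := fun t => by
    refine (hle _).trans (le_of_eq ?_)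
    have hd := det_mul_shear_mul (det_rot a) (det_rot b) t
    have e := extendTop_coe W ⟨_, hd⟩
    refine e.trans (congrArg _ (h.apply_eq _ ?_))
    rw [radius_mul_rot_sq, radius_rot_mul_sq, radius_shear_sq]
  have htop : ∀ t, w (rot a * shear t * rot b) ≠ ⊤ := fun t =>
    ne_top_of_le_ne_top (EReal.coe_ne_top _) (hφ t)
  have hk := hc _ _ (det_rot a) (det_rot b) _
    fun t => (EReal.coe_toReal (htop t) (hbot (rot a * shear t * rot b))).symm
  have := le_biconjugate_of_convexOn_toReal (h := fun t => w (rot a * shear t * rot b))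
    (fun t => hbot _) hφ hk (radius (F : Mat))
  rwa [← hF] at this

theorem Represents.le_biconjugate_of_isShearConvex {φ : ℝ → ℝ} {W : SL(2, ℝ) → ℝ}
    (h : Represents φ W) {w : Mat → EReal} (hbot : NeverBot w) (hle : ∀ F, w F ≤ extendTop W F)
    (hw : IsShearConvex w) (F : SL(2, ℝ)) : w F ≤ biconjugate φ (radius (F : Mat)) := by
  refine h.le_biconjugate_of_convexOn hbot hle (fun A B hA hB k hk => ?_) F
  have := convexOn_toReal_of_ereal (h := fun t => w (A * shear t * B)) (fun t => hbot _)
    (fun t => by rw [hk]; exact EReal.coe_ne_top _) (hw A B hA hB)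
  simpa only [hk, EReal.toReal_coe] using this

theorem Represents.le_biconjugate_of_quasiconvexIneq {φ : ℝ → ℝ} {W : SL(2, ℝ) → ℝ}
    (h : Represents φ W) {w : Mat → EReal} (hw : IsBorelQuasiconvex w)
    (hle : ∀ F, w F ≤ extendTop W F) (hb : LocBddAboveOnDetOne w) (F : SL(2, ℝ)) :
    w F ≤ biconjugate φ (radius (F : Mat)) :=
  h.le_biconjugate_of_convexOn hw.1 hle
    (fun _ _ hA hB _ hk => hw.2.2.convexOn_shear hb hA hB hk) F

/-- Being below the real-valued `W`, the competitor is finite on all of `SL(2)`, so the restriction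
to finite values is void there. -/
theorem LocBddAboveWhereFinite.locBddAboveOnDetOne {w : Mat → EReal} {W : SL(2, ℝ) → ℝ}
    (hw : LocBddAboveWhereFinite w) (hle : ∀ F, w F ≤ extendTop W F) : LocBddAboveOnDetOne w := by
  have hfin : ∀ F : Mat, F.det = 1 → w F ≠ ⊤ := fun F hF =>
    ne_top_of_le_ne_top (EReal.coe_ne_top _) ((hle F).trans (extendTop_coe W ⟨F, hF⟩).le)
  intro F hF
  obtain ⟨U, hU, M, hM⟩ := hw F (hfin F hF)
  exact ⟨U, hU, M, fun G hG hd => hM G hG (hfin G hd)⟩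

theorem LocBddAbove.locBddAboveOnDetOne {w : Mat → EReal} {W : SL(2, ℝ) → ℝ}
    (hW : LocBddAbove W) (hle : ∀ F, w F ≤ extendTop W F) : LocBddAboveOnDetOne w := by
  intro F hF
  obtain ⟨U, hU, M, hM⟩ := hW ⟨F, hF⟩
  obtain ⟨V, hV, hVU⟩ := mem_nhds_subtype _ _ _ |>.1 hU
  refine ⟨V, hV, M, fun G hG hd => (hle G).trans ((extendTop_coe W ⟨G, hd⟩).le.trans ?_)⟩
  exact EReal.coe_le_coe_iff.2 (hM ⟨_, hVU hG, rfl⟩)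

/-! ### The envelopes -/

/-- The conformal extension lies below the extension by `+∞`, so the lower bound is needed only for
the former and the upper bound only for the latter. -/
theorem Represents.envelope_eq {φ ψ : ℝ → ℝ} {W : SL(2, ℝ) → ℝ} (h : Represents φ W)
    (hψ : ∀ x, biconjugate φ x = (ψ x : EReal)) {P : (Mat → EReal) → Prop}
    (hP : P fun F => (ψ (radius F) : EReal)) {F : SL(2, ℝ)}
    (hub : ∀ w, P w → (∀ G, w G ≤ extendTop W G) → w F ≤ biconjugate φ (radius (F : Mat))) :
    envelope P (extendTop W) (F : Mat) = biconjugate φ (radius (F : Mat)) ∧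
      envelope P (conformalExtension φ) (F : Mat) = biconjugate φ (radius (F : Mat)) := by
  have h1 : biconjugate φ (radius (F : Mat)) ≤ envelope P (conformalExtension φ) (F : Mat) := by
    rw [hψ]
    exact le_envelope (w := fun F => (ψ (radius F) : EReal)) hP
      (fun G => hψ (radius G) ▸ biconjugate_le φ _) _
  have h2 := envelope_mono_right (P := P) h.conformalExtension_le (F : Mat)
  have h3 : envelope P (extendTop W) (F : Mat) ≤ biconjugate φ (radius (F : Mat)) :=
    envelope_le hub
  exact ⟨le_antisymm h3 (h1.trans h2), le_antisymm (h2.trans h3) h1⟩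

end PlanarRelaxation

theorem mainTheorem2 (W : SL(2, ℝ) → ℝ) (hobj : IsObjective W) (hiso : IsIsotropic W)
    (hbdd : BddBelow (Set.range W)) :
    (∃! φ : ℝ → ℝ, Represents φ W) ∧
    ∀ φ : ℝ → ℝ, Represents φ W →
      (∀ F : SL(2, ℝ), ((W F : ℝ) : EReal) = conformalExtension φ (F : Mat)) ∧
      ∀ F : SL(2, ℝ),
        (∀ a b : ℝ, HasSingularValues (F : Mat) a b →
          convexEnvelope (fun t : ℝ => ((φ t : ℝ) : EReal)) (a - b) =
            biconjugate φ (radius (F : Mat))) ∧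
        rankOneEnvelope (extendTop W) (F : Mat) = biconjugate φ (radius (F : Mat)) ∧
        quasiconvexEnvelope (extendTop W) (F : Mat) = biconjugate φ (radius (F : Mat)) ∧
        polyconvexEnvelope (extendTop W) (F : Mat) = biconjugate φ (radius (F : Mat)) ∧
        convexEnvelope (extendTop W) (F : Mat) = biconjugate φ (radius (F : Mat)) ∧
        rankOneEnvelope (conformalExtension φ) (F : Mat) = biconjugate φ (radius (F : Mat)) ∧
        quasiconvexEnvelope (conformalExtension φ) (F : Mat) =
          biconjugate φ (radius (F : Mat)) ∧
        polyconvexEnvelope (conformalExtension φ) (F : Mat) = biconjugate φ (radius (F : Mat)) ∧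
        convexEnvelope (conformalExtension φ) (F : Mat) = biconjugate φ (radius (F : Mat)) ∧
        (LocBddAbove W →
          borelQuasiconvexEnvelope (extendTop W) (F : Mat) = biconjugate φ (radius (F : Mat)) ∧
          borelQuasiconvexEnvelope (conformalExtension φ) (F : Mat) =
            biconjugate φ (radius (F : Mat))) := by
  refine ⟨existsUnique_represents hobj hiso, fun φ hφ => ⟨hφ.conformalExtension_eq, fun F => ?_⟩⟩
  have hb := hφ.bddBelow hbdd
  obtain ⟨ψ, hψ⟩ := exists_biconjugate_eq_coe hb
  have hψc := convexOn_of_coe_eq_biconjugate hψ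
  have hψn : ∀ t, ψ (-t) = ψ t := fun t => by
    rw [← EReal.coe_eq_coe_iff, ← hψ, ← hψ, biconjugate_neg hφ.neg]
  have hf := convexOn_comp_radius hψc hψn
  have hψcont : Continuous ψ := continuousOn_univ.1 (hψc.continuousOn isOpen_univ)
  have hq := hf.isQuasiconvex (hψcont.comp continuous_radius)
  have hC := hf.isConvexFn
  have rR := hφ.envelope_eq (F := F) hψ hC.isRankOneConvex fun w hw hle =>
    hφ.le_biconjugate_of_isShearConvex hw.1 hle hw.isShearConvex F
  have rQ := hφ.envelope_eq (F := F) hψ hq fun w hw hle =>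
    hφ.le_biconjugate_of_quasiconvexIneq hw.1 hle (hw.2.locBddAboveOnDetOne hle) F
  have rP := hφ.envelope_eq (F := F) hψ hC.isPolyconvex fun w hw hle =>
    hφ.le_biconjugate_of_isShearConvex hw.neverBot hle hw.isShearConvex F
  have rC := hφ.envelope_eq (F := F) hψ hC fun w hw hle =>
    hφ.le_biconjugate_of_isShearConvex hw.1 hle hw.isRankOneConvex.isShearConvex F
  refine ⟨fun a b hab => ?_, rR.1, rQ.1, rP.1, rC.1, rR.2, rQ.2, rP.2, rC.2, fun hW => ?_⟩
  · rw [convexEnvelope_coe_eq_biconjugate hb]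
    rcases sq_eq_sq_iff_eq_or_eq_neg.1 (sub_sq_of_hasSingularValues F.2 hab) with h | h
    · rw [h]
    · rw [h, biconjugate_neg hφ.neg]
  -- Borel competitors carry no local bound of their own; they inherit one from `W`.
  · exact hφ.envelope_eq (F := F) hψ hq.1 fun w hw hle =>
      hφ.le_biconjugate_of_quasiconvexIneq hw hle (hW.locBddAboveOnDetOne hle) F
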